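/- Let $d\ge 1$. For every nonempty $d$-parallelepiped $\Lambda=\prod_{i=1}^d[a_i,b_i]\cap\mathbb Z^d$ of volume $|\Lambda|$ let $(J'_X)_{X\subseteq\Lambda}$ be independent centered Gaussian variables with variances $\Delta_X^2\ge 0$, let $(\mu'_X)_{X\subseteq\Lambda}$ be real numbers (both $\Delta_X$ and $\mu'_X$ may depend on $\Lambda$), and for $\mu\in\mathbb R$ consider the Hamiltonian $$H_\Lambda(\sigma)=-\sum_{X\subseteq\Lambda}J_X\sigma_X,\qquad J_X=J'_X+\mu\mu'_X,\qquad \sigma\in\{\pm1\}^\Lambda,$$ where $\sigma_X=\prod_{i\in X}\sigma_i$ and $\sigma_\emptyset=0$. Assume thermodynamic stability: there is $\bar c<\infty$ with $\frac1{|\Lambda|}\sum_{X\subseteq\Lambda}|\mu'_X|\le\bar c$ and $\frac1{|\Lambda|}\sum_{X\subseteq\Lambda}\Delta_X^2\le\bar c$ for all $\Lambda$. Let $\mathrm{Av}$ be the average over the $J'_X$, and put $$b_\Lambda(\sigma)=\tfrac1{|\Lambda|}\mathrm{Av}(H_\Lambda(\sigma)),\qquad c_\Lambda(\sigma,\tau)=\tfrac1{|\Lambda|}\mathrm{Cov}(H_\Lambda(\sigma),H_\Lambda(\tau)).$$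 For a function $F$ of $n$ replicas $\sigma^{(1)},\dots,\sigma^{(n)}$ let $$\langle F\rangle=\mathrm{Av}\Big(\sum_{\sigma^{(1)},\dots,\sigma^{(n)}}F\,\frac{e^{-\beta[H_\Lambda(\sigma^{(1)})+\cdots+H_\Lambda(\sigma^{(n)})]}}{\mathcal Z(\beta)^n}\Big),\qquad \mathcal Z(\beta)=\sum_\sigma e^{-\beta H_\Lambda(\sigma)},$$ and write $m_k=b_\Lambda(\sigma^{(k)})$, $q_{k,l}=c_\Lambda(\sigma^{(k)},\sigma^{(l)})$. Let $R\ge 0$ be an integer and let $G$ be a smooth real function of the variables $(m_k)_{k\le R}$ and $(q_{k,l})_{k,l\le R}$ (it is automatically bounded on the values that these take). Define $$g_1(\beta,\mu)=-\beta\Big(\sum_{\substack{k,l=1\\k\ne l}}^R\langle G\,q_{l,k}\rangle-2R\sum_{l=1}^R\langle G\,q_{l,R+1}\rangle+R(R+1)\langle G\,q_{R+1,R+2}\rangle\Big),$$ $$g_2(\beta,\mu)=-\beta\Big(\sum_{k=1}^{R+1}\langle G\,q_{k,R+1}\rangle-(R+1)\langle G\,q_{R+1,R+2}\rangle-\langle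 G\rangle\big(\langle q_{1,1}\rangle-\langle q_{1,2}\rangle\big)\Big).$$ Then for all real $\beta_1\le\beta_2$ and $\mu_1\le\mu_2$, $$\lim_{\Lambda\nearrow\mathbb Z^d}\int_{\mu_1}^{\mu_2}d\mu\int_{\beta_1}^{\beta_2}d\beta\,|g_1(\beta,\mu)|=0,\qquad \lim_{\Lambda\nearrow\mathbb Z^d}\int_{\mu_1}^{\mu_2}d\mu\int_{\beta_1}^{\beta_2}d\beta\,|g_2(\beta,\mu)|=0,$$ where the limit is along the $d$-parallelepipeds directed by inclusion. -/

import Mathlib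

open MeasureTheory ProbabilityTheory Filter Topology
open scoped NNReal ContDiff BigOperators

noncomputable section

namespace SpinGlass

/-- The nonempty `d`-parallelepipeds of `ℤ^d`, ordered by inclusion.  The thermodynamic limit
`Λ ↗ ℤ^d` is the limit along `atTop` of this directed order. -/
abbrev Box (d : ℕ) : Type :=
  {Λ : Finset (Fin d → ℤ) // ∃ a b : Fin d → ℤ, a ≤ b ∧ Λ = Finset.Icc a b}

variable {d : ℕ}

/-- The volume `|Λ|`. -/
def vol (Λ : Box d) : ℝ := (Λ.1.card : ℝ)

/-- Ising configurations `σ = (σ_i)_{i ∈ Λ}` with `σ_i = ±1`. -/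
abbrev Config (Λ : Box d) : Type := Λ.1 → ℤˣ

/-- `σ_X = ∏_{i ∈ X} σ_i`, with the convention `σ_∅ = 0`. -/
def spin {Λ : Box d} (σ : Config Λ) (X : Finset Λ.1) : ℝ :=
  if X = ∅ then 0 else ∏ i ∈ X, ((σ i : ℤ) : ℝ)

/-- The parameters of a Gaussian spin glass: for every volume `Λ` and every `X ⊆ Λ` the
(undeformed) mean `μ'_X` and the standard deviation `Δ_X` of the coupling `J_X`.  They may depend
on `Λ` (as in mean field models); no translation invariance is required. -/
structure Model (d : ℕ) where
  mean : (Λ : Box d) → Finset Λ.1 → ℝ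
  dev : (Λ : Box d) → Finset Λ.1 → ℝ≥0

namespace Model

variable (M : Model d) (Λ : Box d)

/-- Thermodynamic stability. -/
def Stable : Prop :=
  ∃ c : ℝ, ∀ Λ : Box d,
    (1 / vol Λ) * ∑ X : Finset Λ.1, |M.mean Λ X| ≤ c ∧
    (1 / vol Λ) * ∑ X : Finset Λ.1, (M.dev Λ X : ℝ) ^ 2 ≤ c

/-- The joint law of the centered couplings `J'_X`, `X ⊆ Λ`: independent Gaussians, `J'_X` having
mean `0` and variance `Δ_X²`. -/
def disorder : Measure (Finset Λ.1 → ℝ) :=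
  Measure.pi fun X => gaussianReal 0 (M.dev Λ X ^ 2)

/-- The average `Av` over the disorder. -/
def av (f : (Finset Λ.1 → ℝ) → ℝ) : ℝ := ∫ J, f J ∂(M.disorder Λ)

/-- `H_Λ(σ) = - ∑_{X ⊆ Λ} J_X σ_X` with `J_X = J'_X + μ μ'_X`. -/
def hamiltonian (μ : ℝ) (J' : Finset Λ.1 → ℝ) (σ : Config Λ) : ℝ :=
  -∑ X : Finset Λ.1, (J' X + μ * M.mean Λ X) * spin σ X

/-- `B_Λ(σ) = Av(H_Λ(σ))`. -/
def meanH (μ : ℝ) (σ : Config Λ) : ℝ := M.av Λ fun J' => M.hamiltonian Λ μ J' σ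

/-- `C_Λ(σ,τ)`, the covariance of `H_Λ(σ)` and `H_Λ(τ)`. -/
def covH (μ : ℝ) (σ τ : Config Λ) : ℝ :=
  M.av Λ fun J' => (M.hamiltonian Λ μ J' σ - M.meanH Λ μ σ) *
    (M.hamiltonian Λ μ J' τ - M.meanH Λ μ τ)

instance : IsProbabilityMeasure (M.disorder Λ) := by
  unfold disorder; infer_instance

lemma aemeasurable_eval_disorder (X : Finset Λ.1) :
    AEMeasurable (fun J => J X) (M.disorder Λ) := (measurable_pi_apply X).aemeasurable

lemma map_eval_disorder (X : Finset Λ.1) :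
    (M.disorder Λ).map (fun J => J X) = gaussianReal 0 (M.dev Λ X ^ 2) :=
  (measurePreserving_eval (fun X => gaussianReal 0 (M.dev Λ X ^ 2)) X).map_eq

lemma memLp_eval_disorder (X : Finset Λ.1) : MemLp (fun J => J X) 2 (M.disorder Λ) := by
  have h := memLp_id_gaussianReal (μ := 0) (v := M.dev Λ X ^ 2) 2
  rw [← M.map_eval_disorder Λ X] at h
  exact (memLp_map_measure_iff (by fun_prop) (M.aemeasurable_eval_disorder Λ X)).1 h

lemma integral_eval_disorder (X : Finset Λ.1) : ∫ J, J X ∂(M.disorder Λ) = 0 := by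
  have h := integral_map (μ := M.disorder Λ) (φ := fun J => J X) (f := fun x : ℝ => x)
    (M.aemeasurable_eval_disorder Λ X) (by fun_prop)
  rw [M.map_eval_disorder Λ X, integral_id_gaussianReal] at h
  exact h.symm

lemma integral_eval_mul_disorder (X Y : Finset Λ.1) :
    ∫ J, J X * J Y ∂(M.disorder Λ) = if X = Y then (M.dev Λ X : ℝ) ^ 2 else 0 := by
  split_ifs with h
  · subst h
    have h1 := variance_of_integral_eq_zero (X := fun J => J X) (μ := M.disorder Λ)
      (M.aemeasurable_eval_disorder Λ X) (M.integral_eval_disorder Λ X)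
    have h2 := variance_map (μ := M.disorder Λ) (Y := fun J => J X) (X := fun x : ℝ => x)
      (by fun_prop) (M.aemeasurable_eval_disorder Λ X)
    rw [M.map_eval_disorder Λ X, variance_fun_id_gaussianReal] at h2
    have h3 : Var[fun J => J X; M.disorder Λ] = ((M.dev Λ X ^ 2 : ℝ≥0) : ℝ) := h2.symm
    rw [h3] at h1
    push_cast at h1
    rw [h1]
    congr 1
    ext J
    ring
  · have hi : iIndepFun (fun (X : Finset Λ.1) (J : Finset Λ.1 → ℝ) => J X) (M.disorder Λ) :=
      iIndepFun_pi (X := fun _ x => x) (fun _ => by fun_prop)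
    have h2 := (hi.indepFun h).integral_fun_mul_eq_mul_integral
      (M.aemeasurable_eval_disorder Λ X).aestronglyMeasurable
      (M.aemeasurable_eval_disorder Λ Y).aestronglyMeasurable
    rw [h2, M.integral_eval_disorder Λ X, zero_mul]

/-- The explicit form of the mean. -/
lemma meanH_eq (μ : ℝ) (σ : Config Λ) :
    M.meanH Λ μ σ = -∑ X : Finset Λ.1, μ * M.mean Λ X * spin σ X := by
  have hi : ∀ X : Finset Λ.1, Integrable (fun J => J X) (M.disorder Λ) := fun X =>
    (M.memLp_eval_disorder Λ X).integrable (by norm_num)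
  unfold meanH av hamiltonian
  rw [integral_neg, integral_finsetSum]
  · congr 1
    refine Finset.sum_congr rfl fun X _ => ?_
    rw [integral_mul_const, integral_add (hi X) (integrable_const _),
      M.integral_eval_disorder Λ X]
    simp
  · intro X _
    exact ((hi X).add (integrable_const _)).mul_const _

/-- The explicit form of the covariance. -/
lemma covH_eq (μ : ℝ) (σ τ : Config Λ) :
    M.covH Λ μ σ τ = ∑ X : Finset Λ.1, (M.dev Λ X : ℝ) ^ 2 * spin σ X * spin τ X := by
  have hdiff : ∀ (J : Finset Λ.1 → ℝ) (σ : Config Λ),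
      M.hamiltonian Λ μ J σ - M.meanH Λ μ σ = -∑ X : Finset Λ.1, J X * spin σ X := by
    intro J σ
    rw [meanH_eq, hamiltonian, ← sub_eq_zero]
    simp only [add_mul, Finset.sum_add_distrib]
    ring
  have hi : ∀ X Y : Finset Λ.1, Integrable (fun J => J X * J Y) (M.disorder Λ) := fun X Y =>
    (M.memLp_eval_disorder Λ X).integrable_mul (M.memLp_eval_disorder Λ Y)
  have hexp : ∀ J : Finset Λ.1 → ℝ,
      (M.hamiltonian Λ μ J σ - M.meanH Λ μ σ) * (M.hamiltonian Λ μ J τ - M.meanH Λ μ τ) =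
      ∑ X : Finset Λ.1, ∑ Y : Finset Λ.1, (J X * J Y) * (spin σ X * spin τ Y) := by
    intro J
    rw [hdiff, hdiff, neg_mul_neg, Finset.sum_mul_sum]
    refine Finset.sum_congr rfl fun X _ => Finset.sum_congr rfl fun Y _ => ?_
    ring
  unfold covH av
  simp only [hexp]
  rw [integral_finsetSum _ fun X _ => integrable_finsetSum _ fun Y _ => (hi X Y).mul_const _]
  refine Finset.sum_congr rfl fun X _ => ?_
  rw [integral_finsetSum _ fun Y _ => (hi X Y).mul_const _]
  simp only [integral_mul_const, integral_eval_mul_disorder]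
  simp [ite_mul, mul_assoc]

/-- The normalized mean `b_Λ(σ)`. -/
def b (μ : ℝ) (σ : Config Λ) : ℝ := (1 / vol Λ) * M.meanH Λ μ σ

/-- The normalized covariance `c_Λ(σ,τ)`. -/
def c (μ : ℝ) (σ τ : Config Λ) : ℝ := (1 / vol Λ) * M.covH Λ μ σ τ

/-- The random partition function. -/
def partition (β μ : ℝ) (J' : Finset Λ.1 → ℝ) : ℝ :=
  ∑ σ : Config Λ, Real.exp (-β * M.hamiltonian Λ μ J' σ)

/-- The `n`-product random Gibbs-Boltzmann state `Ω`. -/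
def gibbs (β μ : ℝ) (J' : Finset Λ.1 → ℝ) {n : ℕ} (F : (Fin n → Config Λ) → ℝ) : ℝ :=
  ∑ s : Fin n → Config Λ,
    F s * (Real.exp (-β * ∑ k, M.hamiltonian Λ μ J' (s k)) / M.partition Λ β μ J' ^ n)

/-- The quenched equilibrium state `<F> = Av(Ω(F))` of a function of `n` replicas. -/
def quenched (β μ : ℝ) {n : ℕ} (F : (Fin n → Config Λ) → ℝ) : ℝ :=
  M.av Λ fun J' => M.gibbs Λ β μ J' F

/-- The observable `G(b_Λ, c_Λ)` of `R` replicas: `G` evaluated at the magnetizations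
`m_k = b_Λ(σ^(k))` and the overlaps `q_{k,l} = c_Λ(σ^(k),σ^(l))`. -/
def observable (μ : ℝ) {R : ℕ} (G : (Fin R → ℝ) × (Fin R → Fin R → ℝ) → ℝ)
    (s : Fin R → Config Λ) : ℝ :=
  G (fun k => M.b Λ μ (s k), fun k l => M.c Λ μ (s k) (s l))

/-- Among `R + 2` replicas, the replica `k` for `1 ≤ k ≤ R`. -/
abbrev rep {R : ℕ} (k : Fin R) : Fin (R + 2) := Fin.castAdd 2 k

/-- Among `R + 2` replicas, the replica `R + 1`. -/
abbrev repA (R : ℕ) : Fin (R + 2) := Fin.natAdd R 0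

/-- Among `R + 2` replicas, the replica `R + 2`. -/
abbrev repB (R : ℕ) : Fin (R + 2) := Fin.natAdd R 1

/-- `<G q_{k,l}>`, for replicas `k, l` among `R + 2` and an observable `G` of the first `R`. -/
def avGq {R : ℕ} (G : (Fin R → ℝ) × (Fin R → Fin R → ℝ) → ℝ) (β μ : ℝ)
    (k l : Fin (R + 2)) : ℝ :=
  M.quenched Λ β μ (n := R + 2) (fun s =>
    M.observable Λ μ G (fun j => s (rep j)) * M.c Λ μ (s k) (s l))

/-- The function `g₁(β,μ)` in the volume `Λ`. -/
def g₁ {R : ℕ} (G : (Fin R → ℝ) × (Fin R → Fin R → ℝ) → ℝ) (β μ : ℝ) : ℝ :=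
  -β * ((∑ k : Fin R, ∑ l : Fin R, if k ≠ l then M.avGq Λ G β μ (rep l) (rep k) else 0)
      - 2 * R * (∑ l : Fin R, M.avGq Λ G β μ (rep l) (repA R))
      + R * (R + 1) * M.avGq Λ G β μ (repA R) (repB R))

/-- The function `g₂(β,μ)` in the volume `Λ`.  The sum over `1 ≤ k ≤ R + 1` is split into the
terms `k ≤ R` and the term `k = R + 1`. -/
def g₂ {R : ℕ} (G : (Fin R → ℝ) × (Fin R → Fin R → ℝ) → ℝ) (β μ : ℝ) : ℝ :=
  -β * (((∑ k : Fin R, M.avGq Λ G β μ (rep k) (repA R)) + M.avGq Λ G β μ (repA R) (repA R))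
      - (R + 1) * M.avGq Λ G β μ (repA R) (repB R)
      - M.quenched Λ β μ (n := R) (M.observable Λ μ G) *
        (M.quenched Λ β μ (n := 1) (fun s => M.c Λ μ (s 0) (s 0))
          - M.quenched Λ β μ (n := 2) (fun s => M.c Λ μ (s 0) (s 1))))

end Model

end SpinGlass

end

/-! ### Coordinatewise Lipschitz functions on a product space. -/

section Lipschitz

variable {ι : Type*} [Fintype ι]

/-! Put `l = β * μ`: the Boltzmann exponent becomes `-(β * field + l * drift)`, where `field` is the
centered Gaussian part of the energy, and at fixed `l` a derivative in `β` sees only `field`. Let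
E_j (`energyCov`) be 1/|Λ| times the truncated correlation <G field_j> - <G><field>. Gaussian
integration by parts (`avReplica_mul_field`) expresses E_j through overlaps with one additional
replica, and this yields g₂ = E_{R+1} and g₁ = ∑_{k ≤ R} (E_k - E_{R+1}) (`g₂_eq_energyCov`,
`g₁_eq_sum_energyCov`). So it suffices that field/|Λ| concentrates, in the mean over the parameters.

As G is bounded, E_j is controlled by the mean of |field - <field>|/|Λ|, which has a thermal and a
disorder part. The Gibbs variance of the field is minus the β-derivative of its Gibbs mean, so its
β-integral is only O(|Λ|) (`integral_avVar`). For the disorder part, log Z is convex in β and has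
fluctuations O(√|Λ|) by Efron-Stein; convexity transfers this to its derivative
(`abs_gibbsMean_sub_avMean_le`), up to a difference of shifted monotone functions that telescopes
under the β-integral (`integral_fluctBound_le`).

These bounds are uniform in `l`, whereas the theorem integrates over μ, and dl = β dμ degenerates at
β = 0. Near that point integration by parts gives |E_j| ≤ const * |β|, so a cutoff at |β| = ε
repairs the change of variables (`integral_integral_abs_le`). The chosen scales give the rate
|Λ|^(-1/8). -/

lemma continuous_of_abs_sub_le_sum {f : (ι → ℝ) → ℝ} {L : ι → ℝ}
    (hf : ∀ x y, |f x - f y| ≤ ∑ i, L i * |x i - y i|) : Continuous f := by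
  rw [continuous_iff_continuousAt]
  intro y
  refine tendsto_iff_dist_tendsto_zero.2 ?_
  refine squeeze_zero (fun _ => dist_nonneg) (fun x => (Real.dist_eq _ _).trans_le (hf x y)) ?_
  have : Continuous fun x : ι → ℝ => ∑ i, L i * |x i - y i| := by fun_prop
  simpa using this.tendsto y

lemma memLp_two_eval (ν : ι → Measure ℝ) [∀ i, IsProbabilityMeasure (ν i)]
    (hν : ∀ i, MemLp (fun t : ℝ => t) 2 (ν i)) (i : ι) :
    MemLp (fun x : ι → ℝ => x i) 2 (Measure.pi ν) :=
  (hν i).comp_measurePreserving (measurePreserving_eval ν i)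

lemma memLp_two_of_abs_sub_le_sum (ν : ι → Measure ℝ) [∀ i, IsProbabilityMeasure (ν i)]
    (hν : ∀ i, MemLp (fun t : ℝ => t) 2 (ν i)) {f : (ι → ℝ) → ℝ} {L : ι → ℝ}
    (hf : ∀ x y, |f x - f y| ≤ ∑ i, L i * |x i - y i|) : MemLp f 2 (Measure.pi ν) := by
  have hb : MemLp (fun x : ι → ℝ => |f 0| + ∑ i, L i * |x i|) 2 (Measure.pi ν) := by
    have h1 : ∀ i ∈ Finset.univ, MemLp (fun x : ι → ℝ => L i * |x i|) 2 (Measure.pi ν) :=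
      fun i _ => (memLp_two_eval ν hν i).norm.const_mul (L i)
    have h2 : MemLp (fun _ : ι → ℝ => |f 0|) 2 (Measure.pi ν) := memLp_const _
    exact h2.add (memLp_finsetSum _ h1)
  refine hb.mono' (continuous_of_abs_sub_le_sum hf).aestronglyMeasurable
    (Eventually.of_forall fun x => ?_)
  have := hf x 0
  simp only [Pi.zero_apply, sub_zero] at this
  rw [Real.norm_eq_abs]
  have h2 := abs_sub_abs_le_abs_sub (f x) (f 0)
  linarith

end Lipschitz

/-! ### Resampling one coordinate, and the Efron-Stein inequality. -/

section Resampling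

variable {ι : Type*} [Fintype ι] [DecidableEq ι]

/-- It is enough to test on boxes: the preimage of a box is the box with its `i`-th side freed,
times that side. This gives Fubini in one coordinate while keeping the index type intact. -/
lemma measurePreserving_update_pi (ν : ι → Measure ℝ) [∀ i, IsProbabilityMeasure (ν i)] (i : ι) :
    MeasurePreserving (fun p : ℝ × (ι → ℝ) => Function.update p.2 i p.1)
      ((ν i).prod (Measure.pi ν)) (Measure.pi ν) := by
  have hm : Measurable (fun p : ℝ × (ι → ℝ) => Function.update p.2 i p.1) := by
    refine measurable_pi_lambda _ fun j => ?_
    by_cases h : j = i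
    · subst h; simpa using measurable_fst
    · simp only [Function.update_of_ne h]; fun_prop
  refine ⟨hm, (Measure.pi_eq fun s hs => ?_).symm⟩
  rw [Measure.map_apply hm (MeasurableSet.univ_pi hs)]
  have hpre : (fun p : ℝ × (ι → ℝ) => Function.update p.2 i p.1) ⁻¹' (Set.univ.pi s)
      = s i ×ˢ Set.univ.pi (Function.update s i Set.univ) := by
    ext ⟨t, x⟩
    simp only [Set.mem_preimage, Set.mem_pi, Set.mem_univ, true_imp_iff, Set.mem_prod]
    constructor
    · intro h
      refine ⟨by simpa using h i, fun j => ?_⟩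
      by_cases hj : j = i
      · subst hj; simp
      · simpa [Function.update_of_ne hj] using h j
    · rintro ⟨h1, h2⟩ j
      by_cases hj : j = i
      · subst hj; simpa using h1
      · simpa [Function.update_of_ne hj] using h2 j
  rw [hpre, Measure.prod_prod, Measure.pi_pi,
    ← Finset.mul_prod_erase Finset.univ (fun j => ν j (s j)) (Finset.mem_univ i),
    ← Finset.mul_prod_erase Finset.univ (fun j => ν j (Function.update s i Set.univ j))
      (Finset.mem_univ i)]
  simp only [Function.update_self, measure_univ, one_mul]
  congr 1
  refine Finset.prod_congr rfl fun j hj => ?_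
  rw [Function.update_of_ne (Finset.ne_of_mem_erase hj)]

lemma integrable_update_prod (ν : ι → Measure ℝ) [∀ i, IsProbabilityMeasure (ν i)] (i : ι)
    {f : (ι → ℝ) → ℝ} (hf : Integrable f (Measure.pi ν)) :
    Integrable (fun p : (ι → ℝ) × ℝ => f (Function.update p.1 i p.2))
      ((Measure.pi ν).prod (ν i)) :=
  ((measurePreserving_update_pi ν i).integrable_comp_of_integrable hf).swap

lemma integral_integral_update (ν : ι → Measure ℝ) [∀ i, IsProbabilityMeasure (ν i)] (i : ι)
    {f : (ι → ℝ) → ℝ} (hf : Integrable f (Measure.pi ν)) :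
    ∫ x, ∫ t, f (Function.update x i t) ∂(ν i) ∂(Measure.pi ν) = ∫ x, f x ∂(Measure.pi ν) := by
  rw [← integral_prod (fun p : (ι → ℝ) × ℝ => f (Function.update p.1 i p.2))
    (integrable_update_prod ν i hf)]
  rw [← integral_prod_swap]
  have hp := measurePreserving_update_pi ν i
  conv_rhs => rw [← hp.map_eq]
  rw [integral_map hp.measurable.aemeasurable]
  · rfl
  · rw [hp.map_eq]; exact hf.aestronglyMeasurable

/-- The variance is at most the second moment about any constant; centering at `f 0` lets the
Lipschitz bound compare with the second moment of `ν`. -/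
lemma integral_sq_le_sq_integral_add {ν : Measure ℝ} [IsProbabilityMeasure ν]
    (hν : MemLp (fun t : ℝ => t) 2 ν) {f : ℝ → ℝ} {L : ℝ}
    (hf : ∀ x y, |f x - f y| ≤ L * |x - y|) (hm : MemLp f 2 ν) :
    ∫ t, f t ^ 2 ∂ν ≤ (∫ t, f t ∂ν) ^ 2 + L ^ 2 * ∫ t, t ^ 2 ∂ν := by
  have hi : Integrable f ν := hm.integrable (by norm_num)
  have hv : ∫ t, (f t - f 0) ^ 2 ∂ν ≤ L ^ 2 * ∫ t, t ^ 2 ∂ν := by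
    rw [← integral_const_mul]
    refine integral_mono (hm.sub (memLp_const _)).integrable_sq (hν.integrable_sq.const_mul _)
      fun t => ?_
    have := hf t 0
    rw [sub_zero] at this
    have h2 := sq_le_sq' (by linarith [abs_nonneg (f t - f 0)]) this
    rwa [sq_abs, mul_pow, sq_abs] at h2
  have he : ∫ t, (f t - f 0) ^ 2 ∂ν = ∫ t, f t ^ 2 ∂ν - 2 * f 0 * ∫ t, f t ∂ν + f 0 ^ 2 := by
    have : ∀ t, (f t - f 0) ^ 2 = f t ^ 2 - 2 * f 0 * f t + f 0 ^ 2 := fun t => by ring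
    simp only [this]
    have h1 : Integrable (fun t => f t ^ 2) ν := hm.integrable_sq
    have h2 : Integrable (fun t => 2 * f 0 * f t) ν := hi.const_mul _
    have h3 : Integrable (fun t => f t ^ 2 - 2 * f 0 * f t) ν := h1.sub h2
    rw [integral_add h3 (integrable_const _), integral_sub h1 h2, integral_const_mul]
    simp
  nlinarith [sq_nonneg (∫ t, f t ∂ν - f 0)]

/-- **Efron-Stein inequality** for Lipschitz functions of independent variables. -/
lemma integral_sq_le_sq_integral_add_sum (ν : ι → Measure ℝ) [∀ i, IsProbabilityMeasure (ν i)]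
    (hν : ∀ i, MemLp (fun t : ℝ => t) 2 (ν i)) (S : Finset ι) :
    ∀ (f : (ι → ℝ) → ℝ) (L : ι → ℝ), (∀ i ∉ S, L i = 0) →
      (∀ x y, |f x - f y| ≤ ∑ i, L i * |x i - y i|) →
      ∫ x, f x ^ 2 ∂(Measure.pi ν) ≤
        (∫ x, f x ∂(Measure.pi ν)) ^ 2 + ∑ i ∈ S, L i ^ 2 * ∫ t, t ^ 2 ∂(ν i) := by
  -- Induction on the set of coordinates on which `f` may depend.
  induction S using Finset.induction_on with
  | empty =>
    intro f L hL hf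
    have hc : ∀ x, f x = f 0 := fun x => by
      have := hf x 0
      simp only [hL _ (Finset.notMem_empty _), zero_mul, Finset.sum_const_zero] at this
      linarith [abs_nonpos_iff.1 this]
    rw [integral_congr_ae (g := fun _ => f 0) (Eventually.of_forall hc),
      integral_congr_ae (g := fun _ => f 0 ^ 2) (Eventually.of_forall fun x => by simp [hc x])]
    simp
  | insert i S hi ih =>
    intro f L hL hf
    have hsec : ∀ x : ι → ℝ, ∀ s t : ℝ,
        |f (Function.update x i s) - f (Function.update x i t)| ≤ L i * |s - t| := by
      intro x s t
      refine (hf _ _).trans_eq ?_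
      rw [Finset.sum_eq_single i]
      · simp
      · intro j _ hj; simp [Function.update_of_ne hj]
      · simp
    have hsecLp : ∀ x : ι → ℝ, MemLp (fun t => f (Function.update x i t)) 2 (ν i) := by
      intro x
      have hc : Continuous fun t => f (Function.update x i t) :=
        (continuous_of_abs_sub_le_sum hf).comp (continuous_const.update i continuous_id)
      have hb : MemLp (fun t : ℝ => |f (Function.update x i 0)| + L i * |t|) 2 (ν i) :=
        MemLp.add (f := fun _ : ℝ => |f (Function.update x i 0)|) (memLp_const _)
          ((hν i).norm.const_mul (L i))
      refine hb.mono' hc.aestronglyMeasurable (Eventually.of_forall fun t => ?_)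
      have h1 := hsec x t 0
      have h2 := abs_sub_abs_le_abs_sub (f (Function.update x i t)) (f (Function.update x i 0))
      rw [sub_zero] at h1
      rw [Real.norm_eq_abs]; linarith
    have hfLp := memLp_two_of_abs_sub_le_sum ν hν hf
    -- Averaging out coordinate `i` keeps the other Lipschitz constants and replaces the `i`-th by
    -- zero, so the induction hypothesis applies to `g`; the loss in the second moment is the
    -- one-variable bound on each fibre.
    set g : (ι → ℝ) → ℝ := fun x => ∫ t, f (Function.update x i t) ∂(ν i) with hg
    have hgL : ∀ x y, |g x - g y| ≤ ∑ j, Function.update L i 0 j * |x j - y j| := by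
      intro x y
      rw [hg]
      simp only
      rw [← integral_sub ((hsecLp x).integrable (by norm_num))
        ((hsecLp y).integrable (by norm_num))]
      refine abs_integral_le_integral_abs.trans ?_
      have : ∀ t, |f (Function.update x i t) - f (Function.update y i t)| ≤
          ∑ j, Function.update L i 0 j * |x j - y j| := by
        intro t
        refine (hf _ _).trans_eq (Finset.sum_congr rfl fun j _ => ?_)
        by_cases hj : j = i
        · subst hj; simp
        · simp [Function.update_of_ne hj]
      refine (integral_mono (((hsecLp x).sub (hsecLp y)).integrable (by norm_num)).abs
        (integrable_const _) this).trans_eq ?_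
      simp
    have hgLp := memLp_two_of_abs_sub_le_sum ν hν hgL
    have h1 := ih g (Function.update L i 0) (fun j hj => by
      by_cases hji : j = i
      · subst hji; simp
      · rw [Function.update_of_ne hji]; exact hL j (by simp [hji, hj])) hgL
    have h2 : ∫ x, g x ∂(Measure.pi ν) = ∫ x, f x ∂(Measure.pi ν) :=
      integral_integral_update ν i (hfLp.integrable (by norm_num))
    have h3 : ∫ x, f x ^ 2 ∂(Measure.pi ν) ≤
        ∫ x, g x ^ 2 ∂(Measure.pi ν) + L i ^ 2 * ∫ t, t ^ 2 ∂(ν i) := by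
      rw [← integral_integral_update ν i hfLp.integrable_sq]
      have hint := (integrable_update_prod ν i hfLp.integrable_sq).integral_prod_left
      refine (integral_mono hint (hgLp.integrable_sq.add (integrable_const
        (L i ^ 2 * ∫ t, t ^ 2 ∂(ν i)))) fun x =>
        integral_sq_le_sq_integral_add (hν i) (hsec x) (hsecLp x)).trans_eq ?_
      simp only [Pi.add_apply]
      rw [integral_add hgLp.integrable_sq (integrable_const _)]
      simp
    rw [Finset.sum_insert hi]
    have h4 : ∑ j ∈ S, Function.update L i 0 j ^ 2 * ∫ t, t ^ 2 ∂(ν j) =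
        ∑ j ∈ S, L j ^ 2 * ∫ t, t ^ 2 ∂(ν j) :=
      Finset.sum_congr rfl fun j hj => by
        rw [Function.update_of_ne (ne_of_mem_of_not_mem hj hi)]
    rw [h2, h4] at h1
    linarith

end Resampling

/-! ### Gaussian integration by parts. -/

section Stein

lemma hasDerivAt_gaussianPDFReal_zero (v : ℝ≥0) (x : ℝ) :
    HasDerivAt (gaussianPDFReal 0 v) (-(x / v) * gaussianPDFReal 0 v x) x := by
  rw [gaussianPDFReal_def]
  have h : HasDerivAt (fun x : ℝ => -(x - 0) ^ 2 / (2 * v)) (-(x / v)) x := by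
    have := (((hasDerivAt_id x).sub_const 0).pow 2).neg.div_const (2 * (v : ℝ))
    refine this.congr_deriv ?_
    simp
    by_cases hv : (v : ℝ) = 0
    · simp [hv]
    · field_simp
  have := (h.exp.const_mul (√(2 * Real.pi * v))⁻¹)
  refine this.congr_deriv ?_
  ring

/-- **Stein's lemma** for a centered Gaussian variable. -/
lemma integral_mul_gaussianReal (v : ℝ≥0) {f f' : ℝ → ℝ} (hf : ∀ x, HasDerivAt f (f' x) x)
    (hf' : Continuous f') {A A' : ℝ} (hA : ∀ x, |f x| ≤ A) (hA' : ∀ x, |f' x| ≤ A') :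
    ∫ x, x * f x ∂(gaussianReal 0 v) = v * ∫ x, f' x ∂(gaussianReal 0 v) := by
  -- At variance zero the law is a Dirac mass at 0, without a density, and both sides vanish.
  by_cases hv : v = 0
  · subst hv; simp
  have hv' : (v : ℝ) ≠ 0 := by exact_mod_cast hv
  have hcf : Continuous f := continuous_iff_continuousAt.2 fun x => (hf x).continuousAt
  have hpdf := integrable_gaussianPDFReal 0 v
  have hx : Integrable (fun x => x * gaussianPDFReal 0 v x) := by
    have h := (memLp_id_gaussianReal (μ := 0) (v := v) 1).integrable (by simp)
    rw [gaussianReal_of_var_ne_zero _ hv, integrable_withDensity_iff_integrable_smul₀'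
      (measurable_gaussianPDF _ _).aemeasurable
      (ae_of_all _ fun _ => gaussianPDF_lt_top)] at h
    simpa [mul_comm] using h
  have hbdd : ∀ {g h : ℝ → ℝ} {C : ℝ}, Continuous g → (∀ x, |g x| ≤ C) → Integrable h →
      Integrable (fun x => g x * h x) := fun hg hC hh =>
    hh.bdd_mul hg.aestronglyMeasurable (Eventually.of_forall hC)
  have key := integral_mul_deriv_eq_deriv_mul_of_integrable (u := f) (u' := f')
    (v := gaussianPDFReal 0 v) (v' := fun x => -(x / v) * gaussianPDFReal 0 v x)
    (fun x _ => hf x) (fun x _ => hasDerivAt_gaussianPDFReal_zero v x) ?_ ?_ ?_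
  · rw [integral_gaussianReal_eq_integral_smul hv, integral_gaussianReal_eq_integral_smul hv]
    simp only [smul_eq_mul]
    have e1 : ∀ x, f x * (-(x / v) * gaussianPDFReal 0 v x) =
        (-(v : ℝ)⁻¹) * (gaussianPDFReal 0 v x * (x * f x)) := fun x => by ring
    have e2 : ∀ x, f' x * gaussianPDFReal 0 v x = gaussianPDFReal 0 v x * f' x :=
      fun x => mul_comm _ _
    simp only [e1, e2] at key
    rw [integral_const_mul] at key
    rw [neg_mul, neg_inj, inv_mul_eq_iff_eq_mul₀ hv'] at key
    exact key
  · have := (hbdd hcf hA hx).const_mul (-(v : ℝ)⁻¹)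
    refine this.congr (Eventually.of_forall fun x => ?_)
    simp only [Pi.mul_apply]; ring
  · exact hbdd hf' hA' hpdf
  · exact hbdd hcf hA hpdf

/-- Gaussian integration by parts for independent centered variables. -/
lemma integral_eval_mul_pi_gaussianReal {ι : Type*} [Fintype ι] [DecidableEq ι] (v : ι → ℝ≥0)
    (i : ι) {f f' : (ι → ℝ) → ℝ}
    (hf : ∀ x, HasDerivAt (fun t => f (Function.update x i t)) (f' x) (x i))
    (hfc : Continuous f) (hf' : Continuous f') {A A' : ℝ} (hA : ∀ x, |f x| ≤ A)
    (hA' : ∀ x, |f' x| ≤ A') :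
    ∫ x, x i * f x ∂(Measure.pi fun i => gaussianReal 0 (v i)) =
      v i * ∫ x, f' x ∂(Measure.pi fun i => gaussianReal 0 (v i)) := by
  set ν : ι → Measure ℝ := fun i => gaussianReal 0 (v i) with hν
  have hxi : Integrable (fun x : ι → ℝ => x i) (Measure.pi ν) :=
    (memLp_two_eval ν (fun j => memLp_id_gaussianReal 2) i).integrable (by norm_num)
  have h1 : Integrable (fun x => x i * f x) (Measure.pi ν) :=
    (hxi.bdd_mul hfc.aestronglyMeasurable (Eventually.of_forall hA)).congr
      (Eventually.of_forall fun x => mul_comm _ _)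
  have h2 : Integrable f' (Measure.pi ν) :=
    (integrable_const A').mono' hf'.aestronglyMeasurable (Eventually.of_forall hA')
  -- Resampling coordinate `i` on both sides reduces the claim to the one-variable lemma on each
  -- fibre.
  rw [← integral_integral_update ν i h1, ← integral_integral_update ν i h2,
    ← integral_const_mul]
  refine integral_congr_ae (Eventually.of_forall fun x => ?_)
  simp only [Function.update_self]
  refine integral_mul_gaussianReal (v i) (f := fun t => f (Function.update x i t)) (fun t => ?_)
    (hf'.comp (continuous_const.update i continuous_id)) (fun t => hA _) (fun t => hA' _)
  simpa using hf (Function.update x i t)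

end Stein

noncomputable section

/-! ### Free energy and Gibbs weights on a finite set. -/

section Softmax

variable {S : Type*} [Fintype S]

/-- The free energy `log ∑ exp u`. -/
def logSumExp (u : S → ℝ) : ℝ := Real.log (∑ σ, Real.exp (u σ))

/-- The Gibbs weights of the energies `-u`. -/
def softmax (u : S → ℝ) (σ : S) : ℝ := Real.exp (u σ - logSumExp u)

lemma softmax_pos (u : S → ℝ) (σ : S) : 0 < softmax u σ := Real.exp_pos _

lemma softmax_nonneg (u : S → ℝ) (σ : S) : 0 ≤ softmax u σ := (softmax_pos u σ).le

variable [Nonempty S]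

lemma sum_exp_pos (u : S → ℝ) : 0 < ∑ σ, Real.exp (u σ) :=
  Finset.sum_pos (fun _ _ => Real.exp_pos _) Finset.univ_nonempty

lemma softmax_eq_div (u : S → ℝ) (σ : S) :
    softmax u σ = Real.exp (u σ) / ∑ τ, Real.exp (u τ) := by
  rw [softmax, Real.exp_sub, logSumExp, Real.exp_log (sum_exp_pos u)]

lemma sum_softmax (u : S → ℝ) : ∑ σ, softmax u σ = 1 := by
  simp only [softmax_eq_div, ← Finset.sum_div]
  exact div_self (sum_exp_pos u).ne'

lemma softmax_le_one (u : S → ℝ) (σ : S) : softmax u σ ≤ 1 :=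
  sum_softmax u ▸ Finset.single_le_sum (fun τ _ => softmax_nonneg u τ) (Finset.mem_univ σ)

/-- Convexity of the free energy, as a tangent plane inequality: this is Jensen for `exp` under the
Gibbs weights. It yields both the Lipschitz bounds and the convexity in `β` below. -/
lemma logSumExp_add_le (u w : S → ℝ) :
    logSumExp u + ∑ σ, softmax u σ * (w σ - u σ) ≤ logSumExp w := by
  set m := ∑ σ, softmax u σ * (w σ - u σ) with hm
  have h1 : ∑ σ, Real.exp (w σ) =
      Real.exp (logSumExp u + m) * ∑ σ, softmax u σ * Real.exp (w σ - u σ - m) := by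
    rw [Finset.mul_sum]
    refine Finset.sum_congr rfl fun σ _ => ?_
    rw [softmax, ← Real.exp_add, ← Real.exp_add]
    congr 1; ring
  have h2 : 1 ≤ ∑ σ, softmax u σ * Real.exp (w σ - u σ - m) := by
    -- Centering by `m` makes the linear term of `x + 1 ≤ exp x` average to zero.
    have h3 : ∑ σ, softmax u σ * (w σ - u σ - m + 1) = 1 := by
      have : ∀ σ, softmax u σ * (w σ - u σ - m + 1) =
          softmax u σ * (w σ - u σ) + softmax u σ * (1 - m) := fun σ => by ring
      simp only [this, Finset.sum_add_distrib, ← Finset.sum_mul, sum_softmax, ← hm]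
      ring
    rw [← h3]
    exact Finset.sum_le_sum fun σ _ =>
      mul_le_mul_of_nonneg_left (Real.add_one_le_exp _) (softmax_nonneg u σ)
  rw [logSumExp.eq_1 w, h1, Real.le_log_iff_exp_le (by positivity)]
  exact le_mul_of_one_le_right (Real.exp_pos _).le h2

lemma abs_sum_softmax_mul_le (u f : S → ℝ) {A : ℝ} (hf : ∀ σ, |f σ| ≤ A) :
    |∑ σ, softmax u σ * f σ| ≤ A := by
  refine (Finset.abs_sum_le_sum_abs _ _).trans ?_
  calc ∑ σ, |softmax u σ * f σ| ≤ ∑ σ, softmax u σ * A :=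
        Finset.sum_le_sum fun σ _ => by
          rw [abs_mul, abs_of_nonneg (softmax_nonneg u σ)]
          exact mul_le_mul_of_nonneg_left (hf σ) (softmax_nonneg u σ)
    _ = A := by rw [← Finset.sum_mul, sum_softmax, one_mul]

lemma abs_logSumExp_sub_le (u w : S → ℝ) {A : ℝ} (h : ∀ σ, |u σ - w σ| ≤ A) :
    |logSumExp u - logSumExp w| ≤ A := by
  have h1 := logSumExp_add_le u w
  have h2 := logSumExp_add_le w u
  have h3 := abs_le.1 (abs_sum_softmax_mul_le u (fun σ => w σ - u σ)
    (fun σ => (abs_sub_comm _ _).trans_le (h σ)))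
  have h4 := abs_le.1 (abs_sum_softmax_mul_le w (fun σ => u σ - w σ) h)
  rw [abs_le]; constructor <;> linarith [h3.1, h3.2, h4.1, h4.2]

lemma continuous_logSumExp : Continuous (logSumExp : (S → ℝ) → ℝ) :=
  Continuous.log (by fun_prop) fun u => (sum_exp_pos u).ne'

lemma continuous_softmax (σ : S) : Continuous fun u : S → ℝ => softmax u σ :=
  ((continuous_apply σ).sub continuous_logSumExp).rexp

lemma hasDerivAt_logSumExp {u : ℝ → S → ℝ} {u' : S → ℝ} {t : ℝ}
    (h : ∀ σ, HasDerivAt (fun t => u t σ) (u' σ) t) :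
    HasDerivAt (fun t => logSumExp (u t)) (∑ σ, softmax (u t) σ * u' σ) t := by
  have h1 : HasDerivAt (fun t => ∑ σ, Real.exp (u t σ)) (∑ σ, Real.exp (u t σ) * u' σ) t :=
    HasDerivAt.fun_sum fun σ _ => (h σ).exp
  refine (h1.log (sum_exp_pos _).ne').congr_deriv ?_
  rw [Finset.sum_div]
  refine Finset.sum_congr rfl fun σ _ => ?_
  rw [softmax_eq_div]; ring

lemma hasDerivAt_softmax {u : ℝ → S → ℝ} {u' : S → ℝ} {t : ℝ}
    (h : ∀ σ, HasDerivAt (fun t => u t σ) (u' σ) t) (σ : S) :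
    HasDerivAt (fun t => softmax (u t) σ)
      (softmax (u t) σ * (u' σ - ∑ τ, softmax (u t) τ * u' τ)) t :=
  ((h σ).sub (hasDerivAt_logSumExp h)).exp

/-- The product is a single exponential; its `n` normalizations each contribute one Gibbs average,
the origin of the factor `n` in the overlap identities. -/
lemma hasDerivAt_prod_softmax {n : ℕ} {u : ℝ → S → ℝ} {u' : S → ℝ} {t : ℝ}
    (h : ∀ σ, HasDerivAt (fun t => u t σ) (u' σ) t) (s : Fin n → S) :
    HasDerivAt (fun t => ∏ k, softmax (u t) (s k))
      ((∏ k, softmax (u t) (s k)) * (∑ k, u' (s k) - n * ∑ τ, softmax (u t) τ * u' τ)) t := by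
  have h1 : HasDerivAt (fun t => ∑ k, (u t (s k) - logSumExp (u t)))
      (∑ k, (u' (s k) - ∑ τ, softmax (u t) τ * u' τ)) t :=
    HasDerivAt.fun_sum fun k _ => (h (s k)).sub (hasDerivAt_logSumExp h)
  have h2 := h1.exp
  simp only [Real.exp_sum] at h2
  refine h2.congr_deriv ?_
  simp [softmax, Finset.sum_sub_distrib]

end Softmax

/-! ### Averages over independent replicas. -/

section Replicas

variable {S : Type*} [Fintype S]

/-- The expectation of a function of `n` independent replicas with one-replica weights `p`. -/
def replicaMean (p : S → ℝ) {n : ℕ} (F : (Fin n → S) → ℝ) : ℝ := ∑ s, F s * ∏ k, p (s k)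

variable {p : S → ℝ} {n : ℕ}

lemma replicaMean_sub (F F' : (Fin n → S) → ℝ) :
    replicaMean p (fun s => F s - F' s) = replicaMean p F - replicaMean p F' := by
  simp [replicaMean, sub_mul, Finset.sum_sub_distrib]

lemma replicaMean_mul_const (F : (Fin n → S) → ℝ) (c : ℝ) :
    replicaMean p (fun s => F s * c) = replicaMean p F * c := by
  simp only [replicaMean, Finset.sum_mul]
  exact Finset.sum_congr rfl fun s _ => by ring

lemma abs_replicaMean_le (hp : ∀ σ, 0 ≤ p σ) (F : (Fin n → S) → ℝ) :
    |replicaMean p F| ≤ replicaMean p fun s => |F s| := by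
  refine (Finset.abs_sum_le_sum_abs _ _).trans_eq (Finset.sum_congr rfl fun s _ => ?_)
  rw [abs_mul, abs_of_nonneg (a := ∏ k, p (s k)) (Finset.prod_nonneg fun _ _ => hp _)]

lemma replicaMean_mono (hp : ∀ σ, 0 ≤ p σ) {F F' : (Fin n → S) → ℝ} (h : ∀ s, F s ≤ F' s) :
    replicaMean p F ≤ replicaMean p F' :=
  Finset.sum_le_sum fun s _ =>
    mul_le_mul_of_nonneg_right (h s) (Finset.prod_nonneg fun _ _ => hp _)

lemma replicaMean_eval (h1 : ∑ σ, p σ = 1) (l : Fin n) (f : S → ℝ) :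
    replicaMean p (fun s : Fin n → S => f (s l)) = ∑ σ, f σ * p σ := by
  have h : ∀ s : Fin n → S, f (s l) * ∏ k, p (s k) =
      ∏ k, (if k = l then f (s k) else 1) * p (s k) := by
    intro s
    rw [Finset.prod_mul_distrib]
    simp
  simp only [replicaMean, h]
  have := Finset.prod_univ_sum (fun _ : Fin n => (Finset.univ : Finset S))
    (fun k σ => (if k = l then f σ else 1) * p σ)
  rw [Fintype.piFinset_univ] at this
  rw [← this, Finset.prod_eq_single l]
  · simp
  · intro k _ hk; simp [hk, h1]
  · simp

lemma replicaMean_one (h1 : ∑ σ, p σ = 1) :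
    replicaMean p (fun _ : Fin n → S => 1) = 1 := by
  have := Finset.prod_univ_sum (fun _ : Fin n => (Finset.univ : Finset S)) (fun _ σ => p σ)
  rw [Fintype.piFinset_univ] at this
  simp [replicaMean, ← this, h1]

lemma replicaMean_comp_perm (e : Equiv.Perm (Fin n)) (F : (Fin n → S) → ℝ) :
    replicaMean p (fun s => F (s ∘ e)) = replicaMean p F := by
  refine Fintype.sum_equiv (Equiv.arrowCongr e.symm (Equiv.refl S)) _ _ fun s => ?_
  have : (Equiv.arrowCongr e.symm (Equiv.refl S)) s = s ∘ e := by ext k; rfl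
  rw [this]
  congr 1
  exact (Equiv.prod_comp e fun k => p (s k)).symm

/-- Read from right to left, it turns a Gibbs average inside a replica average into one more
replica. -/
lemma replicaMean_succ (F : (Fin (n + 1) → S) → ℝ) :
    replicaMean p F =
      replicaMean p fun s : Fin n → S => ∑ τ, p τ * F (Fin.snoc (α := fun _ => S) s τ) := by
  unfold replicaMean
  rw [← (Fin.snocEquiv (fun _ : Fin (n + 1) => S)).sum_comp, Fintype.sum_prod_type,
    Finset.sum_comm]
  refine Finset.sum_congr rfl fun s _ => ?_
  rw [Finset.sum_mul]
  refine Finset.sum_congr rfl fun τ _ => ?_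
  simp [Fin.snocEquiv, Fin.prod_univ_castSucc]
  ring

lemma replicaMean_castSucc (h1 : ∑ σ, p σ = 1) (F : (Fin n → S) → ℝ) :
    replicaMean p (fun s : Fin (n + 1) → S => F fun k => s k.castSucc) = replicaMean p F := by
  rw [replicaMean_succ]
  simp [← Finset.sum_mul, h1]

lemma replicaMean_abs_le (hp : ∀ σ, 0 ≤ p σ) (h1 : ∑ σ, p σ = 1)
    {F : (Fin n → S) → ℝ} {A : ℝ} (hF : ∀ s, |F s| ≤ A) : |replicaMean p F| ≤ A := by
  refine (abs_replicaMean_le hp F).trans ((replicaMean_mono hp hF).trans_eq ?_)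
  have := replicaMean_mul_const (p := p) (fun _ : Fin n → S => 1) A
  rw [replicaMean_one h1] at this
  simpa using this

end Replicas

end

/-! ### Finite Gaussian systems and integration by parts for quenched averages. -/

noncomputable section

/-- A finite system whose energy is the sum of the Gaussian field `∑ i, J i * coeff σ i`, with
independent centered couplings `J i` of variance `var i`, and of a multiple of `drift`. -/
structure GaussianSystem (ι S : Type*) where
  coeff : S → ι → ℝ
  abs_coeff_le : ∀ σ i, |coeff σ i| ≤ 1
  drift : S → ℝ
  var : ι → ℝ≥0

namespace GaussianSystem

variable {ι S : Type*} [Fintype ι] (Q : GaussianSystem ι S)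

def field (J : ι → ℝ) (σ : S) : ℝ := ∑ i, J i * Q.coeff σ i

def cov (σ τ : S) : ℝ := ∑ i, (Q.var i : ℝ) * Q.coeff σ i * Q.coeff τ i

/-- The exponent of the Boltzmann factor. -/
def expo (β l : ℝ) (J : ι → ℝ) (σ : S) : ℝ := -(β * Q.field J σ + l * Q.drift σ)

def law : Measure (ι → ℝ) := Measure.pi fun i => gaussianReal 0 (Q.var i)

instance : IsProbabilityMeasure Q.law := by unfold law; infer_instance

def totalVar : ℝ := ∑ i, (Q.var i : ℝ)

lemma totalVar_nonneg : 0 ≤ Q.totalVar := Finset.sum_nonneg fun _ _ => NNReal.coe_nonneg _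

lemma abs_cov_le (σ τ : S) : |Q.cov σ τ| ≤ Q.totalVar := by
  refine (Finset.abs_sum_le_sum_abs _ _).trans (Finset.sum_le_sum fun i _ => ?_)
  rw [abs_mul, abs_mul, NNReal.abs_eq, mul_assoc]
  exact mul_le_of_le_one_right (NNReal.coe_nonneg _)
    (mul_le_one₀ (Q.abs_coeff_le σ i) (abs_nonneg _) (Q.abs_coeff_le τ i))

lemma continuous_field (σ : S) : Continuous fun J => Q.field J σ := by
  unfold field; fun_prop

lemma abs_field_sub_le (J J' : ι → ℝ) (σ : S) :
    |Q.field J σ - Q.field J' σ| ≤ ∑ i, |J i - J' i| := by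
  rw [field, field, ← Finset.sum_sub_distrib]
  refine (Finset.abs_sum_le_sum_abs _ _).trans (Finset.sum_le_sum fun i _ => ?_)
  rw [← sub_mul, abs_mul]
  exact mul_le_of_le_one_right (abs_nonneg _) (Q.abs_coeff_le σ i)

lemma abs_field_le (J : ι → ℝ) (σ : S) : |Q.field J σ| ≤ ∑ i, |J i| := by
  simpa [field] using Q.abs_field_sub_le J 0 σ

/-- This sum dominates the field and its Gibbs mean uniformly in `β` and `l`, and four times its
square dominates the Gibbs variance; all dominated convergence below rests on it. -/
lemma memLp_sum_abs : MemLp (fun J : ι → ℝ => ∑ i, |J i|) 2 Q.law :=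
  memLp_finsetSum _ fun i _ => (memLp_two_eval _ (fun _ => memLp_id_gaussianReal 2) i).norm

lemma integrable_sum_abs : Integrable (fun J : ι → ℝ => ∑ i, |J i|) Q.law :=
  Q.memLp_sum_abs.integrable (by norm_num)

lemma integrable_sum_abs_sq : Integrable (fun J : ι → ℝ => (∑ i, |J i|) ^ 2) Q.law :=
  Q.memLp_sum_abs.integrable_sq

lemma integrable_of_abs_le_const {f : (ι → ℝ) → ℝ} (hf : Continuous f) {A : ℝ}
    (hA : ∀ J, |f J| ≤ A) : Integrable f Q.law :=
  (integrable_const A).mono' hf.aestronglyMeasurable (Eventually.of_forall hA)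

lemma integrable_of_abs_le_sum {f : (ι → ℝ) → ℝ} (hf : Continuous f) {A : ℝ}
    (hA : ∀ J, |f J| ≤ A * ∑ i, |J i|) : Integrable f Q.law :=
  (Q.integrable_sum_abs.const_mul A).mono' hf.aestronglyMeasurable (Eventually.of_forall hA)

lemma integrable_of_abs_le_sum_sq {f : (ι → ℝ) → ℝ} (hf : Continuous f) {A : ℝ}
    (hA : ∀ J, |f J| ≤ A * (∑ i, |J i|) ^ 2) : Integrable f Q.law :=
  (Q.integrable_sum_abs_sq.const_mul A).mono' hf.aestronglyMeasurable (Eventually.of_forall hA)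

lemma continuous_expo : Continuous fun q : (ℝ × ℝ) × (ι → ℝ) => Q.expo q.1.1 q.1.2 q.2 := by
  refine continuous_pi fun σ => ?_
  unfold expo field
  fun_prop

lemma hasDerivAt_expo_update [DecidableEq ι] (β l : ℝ) (J : ι → ℝ) (i : ι) (σ : S) (t : ℝ) :
    HasDerivAt (fun t => Q.expo β l (Function.update J i t) σ) (-(β * Q.coeff σ i)) t := by
  unfold expo field
  have h : HasDerivAt (fun t => ∑ j, Function.update J i t j * Q.coeff σ j) (Q.coeff σ i) t := by
    have h1 : HasDerivAt (fun t => ∑ j, Function.update J i t j * Q.coeff σ j)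
        (∑ j, if j = i then Q.coeff σ i else 0) t := by
      refine HasDerivAt.fun_sum fun j _ => ?_
      by_cases hj : j = i
      · subst hj; simpa using (hasDerivAt_id t).mul_const (Q.coeff σ j)
      · simp only [Function.update_of_ne hj, if_neg hj]; exact hasDerivAt_const _ _
    simpa using h1
  exact ((h.const_mul β).add_const _).neg

variable [Fintype S]

/-- The random Gibbs weights. -/
def weight (β l : ℝ) (J : ι → ℝ) : S → ℝ := softmax (Q.expo β l J)

/-- The random free energy. -/
def logZ (β l : ℝ) (J : ι → ℝ) : ℝ := logSumExp (Q.expo β l J)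

def gibbsMean (β l : ℝ) (J : ι → ℝ) : ℝ := ∑ σ, Q.weight β l J σ * Q.field J σ

def gibbsVar (β l : ℝ) (J : ι → ℝ) : ℝ :=
  ∑ σ, Q.weight β l J σ * (Q.field J σ - Q.gibbsMean β l J) ^ 2

def avMean (β l : ℝ) : ℝ := ∫ J, Q.gibbsMean β l J ∂Q.law

def avVar (β l : ℝ) : ℝ := ∫ J, Q.gibbsVar β l J ∂Q.law

/-- The quenched average of a function of `n` replicas. -/
def avReplica (β l : ℝ) {n : ℕ} (F : (Fin n → S) → ℝ) : ℝ :=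
  ∫ J, replicaMean (Q.weight β l J) F ∂Q.law

lemma weight_nonneg (β l : ℝ) (J : ι → ℝ) (σ : S) : 0 ≤ Q.weight β l J σ := softmax_nonneg _ _

lemma gibbsVar_nonneg (β l : ℝ) (J : ι → ℝ) : 0 ≤ Q.gibbsVar β l J :=
  Finset.sum_nonneg fun σ _ => mul_nonneg (Q.weight_nonneg β l J σ) (sq_nonneg _)

lemma avVar_nonneg (β l : ℝ) : 0 ≤ Q.avVar β l := integral_nonneg (Q.gibbsVar_nonneg β l)

lemma prod_weight_nonneg {n : ℕ} (β l : ℝ) (J : ι → ℝ) (s : Fin n → S) :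
    0 ≤ ∏ k, Q.weight β l J (s k) :=
  Finset.prod_nonneg fun _ _ => Q.weight_nonneg β l J _

lemma avReplica_comp_perm {n : ℕ} (β l : ℝ) (e : Equiv.Perm (Fin n)) (F : (Fin n → S) → ℝ) :
    Q.avReplica β l (fun s => F (s ∘ e)) = Q.avReplica β l F := by
  simp only [avReplica, replicaMean_comp_perm]

lemma avReplica_mul_const {n : ℕ} (β l : ℝ) (F : (Fin n → S) → ℝ) (c : ℝ) :
    Q.avReplica β l (fun s => F s * c) = Q.avReplica β l F * c := by
  simp only [avReplica, replicaMean_mul_const, integral_mul_const]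

variable [Nonempty S]

lemma sum_weight (β l : ℝ) (J : ι → ℝ) : ∑ σ, Q.weight β l J σ = 1 := sum_softmax _

lemma weight_le_one (β l : ℝ) (J : ι → ℝ) (σ : S) : Q.weight β l J σ ≤ 1 := softmax_le_one _ _

lemma continuous_weight (σ : S) :
    Continuous fun q : (ℝ × ℝ) × (ι → ℝ) => Q.weight q.1.1 q.1.2 q.2 σ :=
  (continuous_softmax σ).comp Q.continuous_expo

lemma continuous_gibbsMean :
    Continuous fun q : (ℝ × ℝ) × (ι → ℝ) => Q.gibbsMean q.1.1 q.1.2 q.2 :=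
  continuous_finsetSum _ fun σ _ =>
    (Q.continuous_weight σ).mul ((Q.continuous_field σ).comp continuous_snd)

lemma continuous_gibbsVar :
    Continuous fun q : (ℝ × ℝ) × (ι → ℝ) => Q.gibbsVar q.1.1 q.1.2 q.2 :=
  continuous_finsetSum _ fun σ _ => (Q.continuous_weight σ).mul
    ((((Q.continuous_field σ).comp continuous_snd).sub Q.continuous_gibbsMean).pow 2)

lemma continuous_weight_right (β l : ℝ) (σ : S) : Continuous fun J => Q.weight β l J σ :=
  (Q.continuous_weight σ).comp (f := fun J => ((β, l), J)) (by fun_prop)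

lemma continuous_gibbsMean_right (β l : ℝ) : Continuous fun J => Q.gibbsMean β l J :=
  Q.continuous_gibbsMean.comp (f := fun J => ((β, l), J)) (by fun_prop)

lemma continuous_gibbsVar_right (β l : ℝ) : Continuous fun J => Q.gibbsVar β l J :=
  Q.continuous_gibbsVar.comp (f := fun J => ((β, l), J)) (by fun_prop)

lemma continuous_logZ_right (β l : ℝ) : Continuous fun J => Q.logZ β l J :=
  continuous_logSumExp.comp (Q.continuous_expo.comp (f := fun J => ((β, l), J)) (by fun_prop))

lemma abs_gibbsMean_le (β l : ℝ) (J : ι → ℝ) : |Q.gibbsMean β l J| ≤ ∑ i, |J i| :=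
  abs_sum_softmax_mul_le _ _ (Q.abs_field_le J)

lemma abs_gibbsVar_le (β l : ℝ) (J : ι → ℝ) : |Q.gibbsVar β l J| ≤ 4 * (∑ i, |J i|) ^ 2 := by
  refine abs_sum_softmax_mul_le _ _ fun σ => ?_
  have h1 := abs_le.1 (Q.abs_field_le J σ)
  have h2 := abs_le.1 (Q.abs_gibbsMean_le β l J)
  rw [abs_of_nonneg (sq_nonneg _)]
  have h3 := sq_le_sq' (a := Q.field J σ - Q.gibbsMean β l J) (b := 2 * ∑ i, |J i|)
    (by linarith) (by linarith)
  linarith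

lemma integrable_gibbsMean (β l : ℝ) : Integrable (Q.gibbsMean β l) Q.law :=
  Q.integrable_of_abs_le_sum (A := 1) (Q.continuous_gibbsMean_right β l)
    fun J => by simpa using Q.abs_gibbsMean_le β l J

lemma integrable_gibbsVar (β l : ℝ) : Integrable (Q.gibbsVar β l) Q.law :=
  Q.integrable_of_abs_le_sum_sq (Q.continuous_gibbsVar_right β l) (Q.abs_gibbsVar_le β l)

lemma continuous_avMean : Continuous fun q : ℝ × ℝ => Q.avMean q.1 q.2 :=
  continuous_of_dominated (fun q => (Q.continuous_gibbsMean_right q.1 q.2).aestronglyMeasurable)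
    (fun q => Eventually.of_forall (Q.abs_gibbsMean_le q.1 q.2)) Q.integrable_sum_abs
    (Eventually.of_forall fun J =>
      Q.continuous_gibbsMean.comp (f := fun q : ℝ × ℝ => (q, J)) (by fun_prop))

lemma continuous_avVar : Continuous fun q : ℝ × ℝ => Q.avVar q.1 q.2 :=
  continuous_of_dominated (fun q => (Q.continuous_gibbsVar_right q.1 q.2).aestronglyMeasurable)
    (fun q => Eventually.of_forall (Q.abs_gibbsVar_le q.1 q.2))
    (Q.integrable_sum_abs_sq.const_mul 4)
    (Eventually.of_forall fun J =>
      Q.continuous_gibbsVar.comp (f := fun q : ℝ × ℝ => (q, J)) (by fun_prop))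

lemma continuous_prod_weight {n : ℕ} (β l : ℝ) (s : Fin n → S) :
    Continuous fun J => ∏ k, Q.weight β l J (s k) :=
  continuous_finsetProd _ fun k _ => Q.continuous_weight_right β l (s k)

lemma prod_weight_le_one {n : ℕ} (β l : ℝ) (J : ι → ℝ) (s : Fin n → S) :
    ∏ k, Q.weight β l J (s k) ≤ 1 :=
  Finset.prod_le_one (fun _ _ => Q.weight_nonneg β l J _) fun _ _ => Q.weight_le_one β l J _

lemma continuous_replicaMean {n : ℕ} (β l : ℝ) {F : (ι → ℝ) → (Fin n → S) → ℝ}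
    (hF : ∀ s, Continuous fun J => F J s) :
    Continuous fun J => replicaMean (Q.weight β l J) (F J) :=
  continuous_finsetSum _ fun s _ => (hF s).mul (Q.continuous_prod_weight β l s)

lemma abs_replicaMean_weight_le {n : ℕ} (β l : ℝ) (J : ι → ℝ) {F : (Fin n → S) → ℝ} {A : ℝ}
    (hF : ∀ s, |F s| ≤ A) : |replicaMean (Q.weight β l J) F| ≤ A :=
  replicaMean_abs_le (Q.weight_nonneg β l J) (Q.sum_weight β l J) hF

lemma integrable_replicaMean {n : ℕ} (β l : ℝ) (F : (Fin n → S) → ℝ) :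
    Integrable (fun J => replicaMean (Q.weight β l J) F) Q.law := by
  obtain ⟨A, hA⟩ := (Set.finite_range fun s => |F s|).bddAbove
  exact Q.integrable_of_abs_le_const (Q.continuous_replicaMean β l fun s => continuous_const)
    fun J => Q.abs_replicaMean_weight_le β l J fun s => hA ⟨s, rfl⟩

lemma abs_avReplica_le {n : ℕ} (β l : ℝ) {F : (Fin n → S) → ℝ} {A : ℝ}
    (hF : ∀ s, |F s| ≤ A) : |Q.avReplica β l F| ≤ A := by
  refine abs_integral_le_integral_abs.trans ?_
  refine (integral_mono (Q.integrable_replicaMean β l F).abs (integrable_const A) fun J =>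
    Q.abs_replicaMean_weight_le β l J hF).trans_eq ?_
  simp

lemma avReplica_castSucc {n : ℕ} (β l : ℝ) (F : (Fin n → S) → ℝ) :
    Q.avReplica β l (fun s : Fin (n + 1) → S => F fun k => s k.castSucc) = Q.avReplica β l F := by
  simp only [avReplica, replicaMean_castSucc (Q.sum_weight β l _)]

/-- The derivative of the weight of `n` replicas in the direction of a coupling. -/
def gradWeight {n : ℕ} (β l : ℝ) (i : ι) (s : Fin n → S) (J : ι → ℝ) : ℝ :=
  (∏ k, Q.weight β l J (s k)) *
    (-β * (∑ k, Q.coeff (s k) i - n * ∑ τ, Q.weight β l J τ * Q.coeff τ i))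

lemma continuous_gradWeight {n : ℕ} (β l : ℝ) (i : ι) (s : Fin n → S) :
    Continuous (Q.gradWeight β l i s) :=
  (Q.continuous_prod_weight β l s).mul (continuous_const.mul (continuous_const.sub
    (continuous_const.mul (continuous_finsetSum _ fun τ _ =>
      (Q.continuous_weight_right β l τ).mul continuous_const))))

lemma abs_gradWeight_le {n : ℕ} (β l : ℝ) (i : ι) (s : Fin n → S) (J : ι → ℝ) :
    |Q.gradWeight β l i s J| ≤ |β| * (n + n) := by
  rw [gradWeight, abs_mul, abs_mul, abs_neg, abs_of_nonneg (Q.prod_weight_nonneg β l J s)]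
  have h1 : |∑ k, Q.coeff (s k) i| ≤ n := by
    refine (Finset.abs_sum_le_sum_abs _ _).trans ?_
    refine (Finset.sum_le_sum fun k _ => Q.abs_coeff_le (s k) i).trans_eq (by simp)
  have h2 : |n * ∑ τ, Q.weight β l J τ * Q.coeff τ i| ≤ n := by
    rw [abs_mul, Nat.abs_cast]
    exact mul_le_of_le_one_right (Nat.cast_nonneg n)
      (abs_sum_softmax_mul_le _ _ fun τ => Q.abs_coeff_le τ i)
  refine (mul_le_of_le_one_left (by positivity) (Q.prod_weight_le_one β l J s)).trans ?_
  exact mul_le_mul_of_nonneg_left ((abs_sub _ _).trans (add_le_add h1 h2)) (abs_nonneg _)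

lemma integral_coupling_mul_prod_weight [DecidableEq ι] {n : ℕ} (β l : ℝ) (i : ι)
    (s : Fin n → S) :
    ∫ J, J i * ∏ k, Q.weight β l J (s k) ∂Q.law =
      Q.var i * ∫ J, Q.gradWeight β l i s J ∂Q.law := by
  refine integral_eval_mul_pi_gaussianReal Q.var i (f := fun J => ∏ k, Q.weight β l J (s k))
    (A := 1) (fun J => ?_) (Q.continuous_prod_weight β l s) (Q.continuous_gradWeight β l i s)
    (fun J => ?_) (Q.abs_gradWeight_le β l i s)
  · have h := hasDerivAt_prod_softmax (t := J i)
      (fun σ => Q.hasDerivAt_expo_update β l J i σ (J i)) s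
    simp only [Function.update_eq_self] at h
    refine h.congr_deriv ?_
    change (∏ k, Q.weight β l J (s k)) * (_ - n * ∑ τ, Q.weight β l J τ * _) = _
    rw [gradWeight]
    congr 1
    simp only [← neg_mul, mul_left_comm _ (-β), ← Finset.mul_sum]
    ring
  · rw [abs_of_nonneg (Q.prod_weight_nonneg β l J s)]
    exact Q.prod_weight_le_one β l J s

/-- Integration by parts for the quenched state. -/
lemma avReplica_mul_field [DecidableEq ι] {n : ℕ} (β l : ℝ) (F : (Fin n → S) → ℝ)
    (j : Fin n) :
    ∫ J, replicaMean (Q.weight β l J) (fun s => F s * Q.field J (s j)) ∂Q.law =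
      -β * (∑ k : Fin n, Q.avReplica β l (fun s : Fin (n + 1) → S =>
          (F fun k => s k.castSucc) * Q.cov (s j.castSucc) (s k.castSucc))
        - n * Q.avReplica β l (fun s : Fin (n + 1) → S =>
          (F fun k => s k.castSucc) * Q.cov (s j.castSucc) (s (Fin.last n)))) := by
  have hint : ∀ (s : Fin n → S) (i : ι),
      Integrable (fun J => J i * ∏ k, Q.weight β l J (s k)) Q.law := fun s i =>
    Q.integrable_of_abs_le_sum (A := 1)
      ((continuous_apply i).mul (Q.continuous_prod_weight β l s)) fun J => by
        rw [abs_mul, one_mul, abs_of_nonneg (Q.prod_weight_nonneg β l J s)]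
        exact (mul_le_of_le_one_right (abs_nonneg _) (Q.prod_weight_le_one β l J s)).trans
          (Finset.single_le_sum (f := fun i => |J i|) (fun _ _ => abs_nonneg _)
            (Finset.mem_univ i))
  have hint2 : ∀ (s : Fin n → S) (i : ι), Integrable (Q.gradWeight β l i s) Q.law :=
    fun s i => Q.integrable_of_abs_le_const (Q.continuous_gradWeight β l i s)
      (Q.abs_gradWeight_le β l i s)
  -- Expand the field in the couplings, so that integration by parts can be applied to each `J i`
  -- separately.
  have e1 : ∀ J, replicaMean (Q.weight β l J) (fun s => F s * Q.field J (s j)) =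
      ∑ s : Fin n → S, ∑ i, (F s * Q.coeff (s j) i) * (J i * ∏ k, Q.weight β l J (s k)) := by
    intro J
    refine Finset.sum_congr rfl fun s _ => ?_
    change F s * (∑ i, J i * Q.coeff (s j) i) * _ = _
    rw [Finset.mul_sum, Finset.sum_mul]
    exact Finset.sum_congr rfl fun i _ => by ring
  -- After integration by parts the sum over couplings reassembles into covariances: with each of
  -- the `n` replicas, and `n` times with an independent Gibbs sample `τ`.
  have e2 : ∀ J, ∑ s : Fin n → S, ∑ i, (F s * Q.coeff (s j) i) * (Q.var i *
      Q.gradWeight β l i s J) =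
      -β * (∑ k : Fin n, replicaMean (Q.weight β l J) (fun s => F s * Q.cov (s j) (s k))
        - n * replicaMean (Q.weight β l J) (fun s =>
          ∑ τ, Q.weight β l J τ * (F s * Q.cov (s j) τ))) := by
    intro J
    simp only [replicaMean]
    rw [Finset.sum_comm (γ := Fin n), Finset.mul_sum (a := (n : ℝ)), ← Finset.sum_sub_distrib,
      Finset.mul_sum]
    refine Finset.sum_congr rfl fun s _ => ?_
    have k1 : ∑ k, Q.cov (s j) (s k) =
        ∑ i, Q.var i * Q.coeff (s j) i * ∑ k, Q.coeff (s k) i := by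
      simp only [cov, Finset.mul_sum]
      exact Finset.sum_comm
    have k2 : ∑ τ, Q.weight β l J τ * Q.cov (s j) τ =
        ∑ i, Q.var i * Q.coeff (s j) i * ∑ τ, Q.weight β l J τ * Q.coeff τ i := by
      simp only [cov, Finset.mul_sum]
      rw [Finset.sum_comm]
      exact Finset.sum_congr rfl fun i _ => Finset.sum_congr rfl fun τ _ => by ring
    have k3 : ∑ k, F s * Q.cov (s j) (s k) * ∏ k, Q.weight β l J (s k) =
        F s * (∏ k, Q.weight β l J (s k)) * ∑ k, Q.cov (s j) (s k) := by
      rw [Finset.mul_sum]; exact Finset.sum_congr rfl fun i _ => by ring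
    have k4 : ∑ τ, Q.weight β l J τ * (F s * Q.cov (s j) τ) =
        F s * ∑ τ, Q.weight β l J τ * Q.cov (s j) τ := by
      rw [Finset.mul_sum]; exact Finset.sum_congr rfl fun i _ => by ring
    rw [k3, k4, k1, k2]
    have k5 : ∀ i, F s * Q.coeff (s j) i * (Q.var i * Q.gradWeight β l i s J) =
        (-β * F s * ∏ k, Q.weight β l J (s k)) *
          (Q.var i * Q.coeff (s j) i * ∑ k, Q.coeff (s k) i) -
        (-β * n * F s * ∏ k, Q.weight β l J (s k)) *
          (Q.var i * Q.coeff (s j) i * ∑ τ, Q.weight β l J τ * Q.coeff τ i) := fun i => by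
      rw [gradWeight]; ring
    simp only [k5, Finset.sum_sub_distrib, ← Finset.mul_sum]
    ring
  have e3 : ∫ J, ∑ s : Fin n → S, ∑ i, (F s * Q.coeff (s j) i) * (Q.var i *
      Q.gradWeight β l i s J) ∂Q.law = ∑ s : Fin n → S, ∑ i, (F s * Q.coeff (s j) i) *
        (Q.var i * ∫ J, Q.gradWeight β l i s J ∂Q.law) := by
    rw [integral_finsetSum _ fun s _ => integrable_finsetSum _ fun i _ =>
      ((hint2 s i).const_mul _).const_mul _]
    simp only [integral_finsetSum _ fun i _ => ((hint2 _ i).const_mul _).const_mul _,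
      integral_const_mul]
  simp only [e1]
  rw [integral_finsetSum _ fun s _ => integrable_finsetSum _ fun i _ => (hint s i).const_mul _]
  simp only [integral_finsetSum _ fun i _ => (hint _ i).const_mul _, integral_const_mul,
    integral_coupling_mul_prod_weight]
  rw [← e3]
  simp only [e2]
  -- The sample `τ` becomes replica `n + 1`.
  have e4 : ∀ J, replicaMean (Q.weight β l J) (fun s : Fin n → S =>
          ∑ τ, Q.weight β l J τ * (F s * Q.cov (s j) τ)) =
      replicaMean (Q.weight β l J) (fun s : Fin (n + 1) → S =>
          (F fun k => s k.castSucc) * Q.cov (s j.castSucc) (s (Fin.last n))) := fun J => by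
    rw [replicaMean_succ]; simp
  simp only [e4, integral_const_mul]
  rw [integral_sub (integrable_finsetSum _ fun k _ => Q.integrable_replicaMean β l _)
    ((Q.integrable_replicaMean β l _).const_mul _), integral_const_mul,
    integral_finsetSum _ fun k _ => Q.integrable_replicaMean β l _]
  congr 3
  funext k
  exact (Q.avReplica_castSucc β l fun s : Fin n → S => F s * Q.cov (s j) (s k)).symm

lemma avMean_eq [DecidableEq ι] (β l : ℝ) :
    Q.avMean β l = -β * (Q.avReplica β l (fun s : Fin 2 → S => Q.cov (s 0) (s 0))
      - Q.avReplica β l (fun s : Fin 2 → S => Q.cov (s 0) (s 1))) := by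
  have h := Q.avReplica_mul_field β l (fun _ : Fin 1 → S => 1) 0
  simp only [one_mul, replicaMean_eval (Q.sum_weight β l _) (0 : Fin 1) (Q.field _),
    Fin.sum_univ_one, Nat.cast_one] at h
  rw [avMean]
  simp only [gibbsMean, mul_comm (Q.weight _ _ _ _)]
  exact h

/-- The average energy is of the order of the total variance, uniformly in `l`; a direct estimate by
the couplings would lose this. -/
lemma abs_avMean_le [DecidableEq ι] (β l : ℝ) :
    |Q.avMean β l| ≤ 2 * |β| * Q.totalVar := by
  rw [avMean_eq, abs_mul, abs_neg]
  have h1 := Q.abs_avReplica_le β l (F := fun s : Fin 2 → S => Q.cov (s 0) (s 0))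
    fun s => Q.abs_cov_le _ _
  have h2 := Q.abs_avReplica_le β l (F := fun s : Fin 2 → S => Q.cov (s 0) (s 1))
    fun s => Q.abs_cov_le _ _
  nlinarith [abs_sub (Q.avReplica β l fun s : Fin 2 → S => Q.cov (s 0) (s 0))
    (Q.avReplica β l fun s : Fin 2 → S => Q.cov (s 0) (s 1)), abs_nonneg β]

end GaussianSystem

end

/-! ### Thermal and disorder fluctuations of the Gaussian energy. -/

noncomputable section

namespace GaussianSystem

variable {ι S : Type*} [Fintype ι] (Q : GaussianSystem ι S) [Fintype S] [Nonempty S]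

lemma sum_weight_mul_sub_gibbsMean (β l : ℝ) (J : ι → ℝ) :
    ∑ σ, Q.weight β l J σ * (Q.field J σ - Q.gibbsMean β l J) = 0 := by
  simp only [mul_sub, Finset.sum_sub_distrib, ← Finset.sum_mul, sum_weight, gibbsMean]
  ring

lemma hasDerivAt_gibbsMean (β l : ℝ) (J : ι → ℝ) :
    HasDerivAt (fun β => Q.gibbsMean β l J) (-Q.gibbsVar β l J) β := by
  have he : ∀ σ, HasDerivAt (fun β => Q.expo β l J σ) (-Q.field J σ) β := fun σ => by
    unfold expo
    refine (((hasDerivAt_id β).mul_const (Q.field J σ)).add_const (l * Q.drift σ)).fun_neg.congr_deriv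
      (by simp)
  have h : HasDerivAt (fun β => Q.gibbsMean β l J) _ β :=
    HasDerivAt.fun_sum fun σ _ => (hasDerivAt_softmax he σ).mul_const (Q.field J σ)
  refine h.congr_deriv ?_
  have h1 : ∀ σ, softmax (Q.expo β l J) σ *
      (-Q.field J σ - ∑ τ, softmax (Q.expo β l J) τ * -Q.field J τ) * Q.field J σ =
      -(Q.weight β l J σ * (Q.field J σ - Q.gibbsMean β l J) ^ 2) -
        Q.gibbsMean β l J * (Q.weight β l J σ * (Q.field J σ - Q.gibbsMean β l J)) := by
    intro σ
    have : ∑ τ, softmax (Q.expo β l J) τ * -Q.field J τ = -Q.gibbsMean β l J := by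
      simp [gibbsMean, weight]
    rw [this, weight]; ring
  simp only [h1, Finset.sum_sub_distrib, ← Finset.mul_sum, sum_weight_mul_sub_gibbsMean]
  simp [gibbsVar]

lemma hasDerivAt_avMean (β l : ℝ) :
    HasDerivAt (fun β => Q.avMean β l) (-Q.avVar β l) β := by
  have h := hasDerivAt_integral_of_dominated_loc_of_deriv_le (μ := Q.law) (x₀ := β)
    (s := Set.univ) (F := fun β J => Q.gibbsMean β l J) (F' := fun β J => -Q.gibbsVar β l J)
    (bound := fun J => 4 * (∑ i, |J i|) ^ 2) Filter.univ_mem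
    (Eventually.of_forall fun β => (Q.continuous_gibbsMean_right β l).aestronglyMeasurable)
    (Q.integrable_gibbsMean β l) (Q.continuous_gibbsVar_right β l).neg.aestronglyMeasurable
    (Eventually.of_forall fun J β _ => by
      rw [norm_neg]; exact Q.abs_gibbsVar_le β l J)
    (Q.integrable_sum_abs_sq.const_mul 4)
    (Eventually.of_forall fun J β _ => Q.hasDerivAt_gibbsMean β l J)
  have h2 := h.2
  rw [integral_neg] at h2
  exact h2

/-- The variance is minus the derivative of the mean, so its `β`-integral is of first order in
`totalVar`. This controls the thermal fluctuations. -/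
lemma integral_avVar (β₁ β₂ l : ℝ) :
    ∫ β in β₁..β₂, Q.avVar β l = Q.avMean β₁ l - Q.avMean β₂ l := by
  have hc : Continuous fun β => -Q.avVar β l :=
    (Q.continuous_avVar.comp (f := fun β : ℝ => (β, l)) (by fun_prop)).neg
  have h := intervalIntegral.integral_eq_sub_of_hasDerivAt
    (fun β _ => Q.hasDerivAt_avMean β l) (hc.intervalIntegrable β₁ β₂)
  rw [intervalIntegral.integral_neg] at h
  linarith

lemma logZ_sub_le (β β' l : ℝ) (J : ι → ℝ) :
    Q.logZ β l J - (β' - β) * Q.gibbsMean β l J ≤ Q.logZ β' l J := by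
  refine le_trans (le_of_eq ?_) (logSumExp_add_le (Q.expo β l J) (Q.expo β' l J))
  rw [logZ, sub_eq_add_neg, gibbsMean, ← neg_mul, Finset.mul_sum]
  congr 1
  exact Finset.sum_congr rfl fun σ _ => by rw [weight, expo, expo]; ring

lemma abs_logZ_sub_le (β l : ℝ) (J J' : ι → ℝ) :
    |Q.logZ β l J - Q.logZ β l J'| ≤ ∑ i, |β| * |J i - J' i| := by
  refine abs_logSumExp_sub_le _ _ fun σ => ?_
  have : Q.expo β l J σ - Q.expo β l J' σ = -(β * (Q.field J σ - Q.field J' σ)) := by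
    rw [expo, expo]; ring
  rw [this, abs_neg, abs_mul, ← Finset.mul_sum]
  exact mul_le_mul_of_nonneg_left (Q.abs_field_sub_le J J' σ) (abs_nonneg β)

lemma memLp_logZ (β l : ℝ) : MemLp (Q.logZ β l) 2 Q.law :=
  memLp_two_of_abs_sub_le_sum _ (fun _ => memLp_id_gaussianReal 2) (Q.abs_logZ_sub_le β l)

lemma integrable_logZ (β l : ℝ) : Integrable (Q.logZ β l) Q.law :=
  (Q.memLp_logZ β l).integrable (by norm_num)

/-- The average free energy. -/
def avLogZ (β l : ℝ) : ℝ := ∫ J, Q.logZ β l J ∂Q.law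

/-- The fluctuation of the free energy. -/
def logZFluct (β l : ℝ) (J : ι → ℝ) : ℝ := Q.logZ β l J - Q.avLogZ β l

lemma memLp_logZFluct (β l : ℝ) : MemLp (Q.logZFluct β l) 2 Q.law :=
  (Q.memLp_logZ β l).sub (memLp_const _)

lemma integral_sq_id_gaussianReal (v : ℝ≥0) : ∫ t, t ^ 2 ∂(gaussianReal 0 v) = v := by
  have h := variance_fun_id_gaussianReal (μ := 0) (v := v)
  rwa [variance_of_integral_eq_zero (by fun_prop) integral_id_gaussianReal] at h

lemma integral_sq_le_of_memLp {Ω : Type*} [MeasurableSpace Ω] {P : Measure Ω}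
    [IsProbabilityMeasure P] {f : Ω → ℝ} (hf : MemLp f 2 P) :
    (∫ x, f x ∂P) ^ 2 ≤ ∫ x, f x ^ 2 ∂P := by
  have h := variance_nonneg f P
  rw [variance_eq_sub hf] at h
  simpa using h

/-- The free energy is `|β|`-Lipschitz in each coupling, so Efron-Stein bounds its variance by `β ^
2 * totalVar`; Jensen passes to the first moment. -/
lemma integral_abs_logZFluct_le [DecidableEq ι] (β l : ℝ) :
    ∫ J, |Q.logZFluct β l J| ∂Q.law ≤ |β| * √Q.totalVar := by
  have h1 := integral_sq_le_sq_integral_add_sum (fun i => gaussianReal 0 (Q.var i))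
    (fun _ => memLp_id_gaussianReal 2) Finset.univ (Q.logZ β l) (fun _ => |β|) (by simp)
    (Q.abs_logZ_sub_le β l)
  have h2 : ∑ i, |β| ^ 2 * ∫ t, t ^ 2 ∂(gaussianReal 0 (Q.var i)) = β ^ 2 * Q.totalVar := by
    simp only [integral_sq_id_gaussianReal, ← Finset.mul_sum, totalVar, sq_abs]
  have h3 : ∫ J, Q.logZFluct β l J ^ 2 ∂Q.law =
      ∫ J, Q.logZ β l J ^ 2 ∂Q.law - (∫ J, Q.logZ β l J ∂Q.law) ^ 2 := by
    have h := variance_eq_sub (Q.memLp_logZ β l)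
    rw [variance_eq_integral (Q.continuous_logZ_right β l).measurable.aemeasurable] at h
    exact h
  have h4 := integral_sq_le_of_memLp (Q.memLp_logZFluct β l).norm
  simp only [Real.norm_eq_abs, sq_abs] at h4
  refine abs_le_of_sq_le_sq' ?_ (by positivity) |>.2
  rw [mul_pow, sq_abs, Real.sq_sqrt Q.totalVar_nonneg]
  rw [h2] at h1
  change ∫ J, Q.logZ β l J ^ 2 ∂Q.law ≤ (∫ J, Q.logZ β l J ∂Q.law) ^ 2 + _ at h1
  linarith

lemma gibbsMean_anti (l : ℝ) (J : ι → ℝ) : Antitone fun β => Q.gibbsMean β l J := by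
  intro β β' h
  rcases h.eq_or_lt with rfl | h
  · rfl
  have h1 := Q.logZ_sub_le β β' l J
  have h2 := Q.logZ_sub_le β' β l J
  have : (β' - β) * (Q.gibbsMean β' l J - Q.gibbsMean β l J) ≤ 0 := by linarith
  nlinarith

lemma avMean_anti (l : ℝ) : Antitone fun β => Q.avMean β l := fun _ _ h =>
  integral_mono (Q.integrable_gibbsMean _ l) (Q.integrable_gibbsMean _ l)
    fun J => Q.gibbsMean_anti l J h

lemma avLogZ_sub_le (β β' l : ℝ) :
    Q.avLogZ β l - (β' - β) * Q.avMean β l ≤ Q.avLogZ β' l := by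
  rw [avLogZ, avMean, ← integral_const_mul, ← integral_sub (Q.integrable_logZ β l)
    ((Q.integrable_gibbsMean β l).const_mul _)]
  exact integral_mono ((Q.integrable_logZ β l).sub ((Q.integrable_gibbsMean β l).const_mul _))
    (Q.integrable_logZ β' l) fun J => Q.logZ_sub_le β β' l J

/-- Closeness of convex functions gives closeness of derivatives: the tangent of the random free
energy at `β` is compared with the tangents of its average at `β ± y`. The last term is the change
of slope of the average over this window. -/
lemma abs_gibbsMean_sub_avMean_le {y : ℝ} (hy : 0 < y) (β l : ℝ) (J : ι → ℝ) :
    |Q.gibbsMean β l J - Q.avMean β l| ≤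
      (|Q.logZFluct (β + y) l J| + |Q.logZFluct β l J| + |Q.logZFluct (β - y) l J|) / y +
        (Q.avMean (β - y) l - Q.avMean (β + y) l) := by
  have g1 := Q.logZ_sub_le β (β + y) l J
  have g2 := Q.logZ_sub_le β (β - y) l J
  have p1 := Q.avLogZ_sub_le (β + y) β l
  have p2 := Q.avLogZ_sub_le (β - y) β l
  have m1 : Q.avMean (β + y) l ≤ Q.avMean β l := Q.avMean_anti l (by linarith)
  have m2 : Q.avMean β l ≤ Q.avMean (β - y) l := Q.avMean_anti l (by linarith)
  have f1 := abs_le.1 (le_refl |Q.logZFluct (β + y) l J|)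
  have f2 := abs_le.1 (le_refl |Q.logZFluct β l J|)
  have f3 := abs_le.1 (le_refl |Q.logZFluct (β - y) l J|)
  have d1 : Q.logZFluct (β + y) l J = Q.logZ (β + y) l J - Q.avLogZ (β + y) l := rfl
  have d2 : Q.logZFluct β l J = Q.logZ β l J - Q.avLogZ β l := rfl
  have d3 : Q.logZFluct (β - y) l J = Q.logZ (β - y) l J - Q.avLogZ (β - y) l := rfl
  have n1 := abs_nonneg (Q.logZFluct (β + y) l J)
  have n3 := abs_nonneg (Q.logZFluct (β - y) l J)
  rw [← sub_le_iff_le_add, le_div_iff₀ hy]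
  have hm : |Q.gibbsMean β l J - Q.avMean β l| * y =
      |y * (Q.gibbsMean β l J - Q.avMean β l)| := by rw [abs_mul, abs_of_pos hy, mul_comm]
  rw [sub_mul, hm, sub_le_iff_le_add, abs_le]
  have m1' := mul_le_mul_of_nonneg_left m1 hy.le
  have m2' := mul_le_mul_of_nonneg_left m2 hy.le
  constructor <;> nlinarith

lemma integral_abs_gibbsMean_sub_le [DecidableEq ι] {y : ℝ} (hy : 0 < y) (β l : ℝ) :
    ∫ J, |Q.gibbsMean β l J - Q.avMean β l| ∂Q.law ≤
      3 * (|β| + y) * √Q.totalVar / y + (Q.avMean (β - y) l - Q.avMean (β + y) l) := by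
  have hi : ∀ β, Integrable (fun J => |Q.logZFluct β l J|) Q.law := fun β =>
    ((Q.memLp_logZFluct β l).integrable (by norm_num)).abs
  have hs₁ : Integrable (fun J => |Q.logZFluct (β + y) l J| + |Q.logZFluct β l J|) Q.law :=
    (hi (β + y)).add (hi β)
  have hs : Integrable (fun J => |Q.logZFluct (β + y) l J| + |Q.logZFluct β l J| +
      |Q.logZFluct (β - y) l J|) Q.law := hs₁.add (hi (β - y))
  have hs' : Integrable (fun J => (|Q.logZFluct (β + y) l J| + |Q.logZFluct β l J| +
      |Q.logZFluct (β - y) l J|) / y) Q.law := hs.div_const y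
  refine (integral_mono ((Q.integrable_gibbsMean β l).sub (integrable_const _)).abs
    (hs'.add (integrable_const _)) (Q.abs_gibbsMean_sub_avMean_le hy β l)).trans ?_
  simp only [Pi.add_apply]
  rw [integral_add hs' (integrable_const _), integral_div,
    integral_add hs₁ (hi (β - y)), integral_add (hi (β + y)) (hi β)]
  simp only [integral_const, probReal_univ, one_smul]
  gcongr
  have a1 := Q.integral_abs_logZFluct_le (β + y) l
  have a2 := Q.integral_abs_logZFluct_le β l
  have a3 := Q.integral_abs_logZFluct_le (β - y) l
  have b1 : |β + y| ≤ |β| + y := (abs_add_le β y).trans_eq (by rw [abs_of_pos hy])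
  have b3 : |β - y| ≤ |β| + y := (abs_sub β y).trans_eq (by rw [abs_of_pos hy])
  have hsq := Real.sqrt_nonneg Q.totalVar
  have c1 := mul_le_mul_of_nonneg_right b1 hsq
  have c3 := mul_le_mul_of_nonneg_right b3 hsq
  have c2 := mul_nonneg hy.le hsq
  nlinarith

/-- The bound on the fluctuations of the field in the quenched state. -/
def fluctBound (η y β l : ℝ) : ℝ :=
  η + Q.avVar β l / η + 3 * (|β| + y) * √Q.totalVar / y +
    (Q.avMean (β - y) l - Q.avMean (β + y) l)

lemma fluctBound_nonneg {η y : ℝ} (hη : 0 < η) (hy : 0 < y) (β l : ℝ) :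
    0 ≤ Q.fluctBound η y β l := by
  have h1 := Q.avVar_nonneg β l
  have h2 : Q.avMean (β + y) l ≤ Q.avMean (β - y) l := Q.avMean_anti l (by linarith)
  have h3 : 0 ≤ 3 * (|β| + y) * √Q.totalVar / y := by positivity
  have h4 : 0 ≤ Q.avVar β l / η := by positivity
  unfold fluctBound
  linarith

lemma continuous_fluctBound (η y : ℝ) :
    Continuous fun q : ℝ × ℝ => Q.fluctBound η y q.1 q.2 := by
  have h1 := Q.continuous_avVar
  have h2 := Q.continuous_avMean.comp (f := fun q : ℝ × ℝ => (q.1 - y, q.2)) (by fun_prop)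
  have h3 := Q.continuous_avMean.comp (f := fun q : ℝ × ℝ => (q.1 + y, q.2)) (by fun_prop)
  simp only [Function.comp_def] at h2 h3
  unfold fluctBound
  fun_prop

/-- Functions of the replicas decorrelate from the field of a replica up to the fluctuations of
the field. -/
lemma abs_integral_replicaMean_mul_field_sub_le [DecidableEq ι] {n : ℕ} {η y : ℝ} (hη : 0 < η)
    (hy : 0 < y) (β l : ℝ) {F : (Fin n → S) → ℝ} {A : ℝ} (hF : ∀ s, |F s| ≤ A) (j : Fin n) :
    |∫ J, replicaMean (Q.weight β l J) (fun s => F s * Q.field J (s j)) ∂Q.law -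
      Q.avReplica β l F * Q.avMean β l| ≤ A * Q.fluctBound η y β l := by
  have hA : 0 ≤ A := by
    obtain ⟨s⟩ : Nonempty (Fin n → S) := inferInstance
    exact (abs_nonneg _).trans (hF s)
  set m := Q.avMean β l
  have hi1 : Integrable (fun J => replicaMean (Q.weight β l J)
      (fun s => F s * (Q.field J (s j) - m))) Q.law := by
    refine ((Q.integrable_sum_abs.add (integrable_const |m|)).const_mul A).mono'
      (Q.continuous_replicaMean β l fun s => continuous_const.mul
        ((Q.continuous_field _).sub continuous_const)).aestronglyMeasurable
      (Eventually.of_forall fun J => Q.abs_replicaMean_weight_le β l J fun s => ?_)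
    rw [abs_mul]
    exact mul_le_mul (hF s) ((abs_sub _ _).trans (add_le_add (Q.abs_field_le J _) le_rfl))
      (abs_nonneg _) hA
  have hi2 : Integrable (fun J => |Q.gibbsMean β l J - m|) Q.law :=
    ((Q.integrable_gibbsMean β l).sub (integrable_const _)).abs
  have e1 : ∫ J, replicaMean (Q.weight β l J) (fun s => F s * Q.field J (s j)) ∂Q.law -
      Q.avReplica β l F * m = ∫ J, replicaMean (Q.weight β l J)
        (fun s => F s * (Q.field J (s j) - m)) ∂Q.law := by
    rw [sub_eq_iff_eq_add, avReplica, ← integral_mul_const,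
      ← integral_add hi1 ((Q.integrable_replicaMean β l F).mul_const m)]
    refine integral_congr_ae (Eventually.of_forall fun J => ?_)
    simp only [mul_sub, replicaMean_sub, replicaMean_mul_const]
    ring
  have e2 : ∀ J, |replicaMean (Q.weight β l J) (fun s => F s * (Q.field J (s j) - m))| ≤
      A * ((η + Q.gibbsVar β l J / η) + |Q.gibbsMean β l J - m|) := by
    intro J
    refine (abs_replicaMean_le (Q.weight_nonneg β l J) _).trans ?_
    have hpt : ∀ s : Fin n → S, |F s * (Q.field J (s j) - m)| ≤
        ((η + (Q.field J (s j) - Q.gibbsMean β l J) ^ 2 / η) + |Q.gibbsMean β l J - m|) * A := by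
      intro s
      rw [abs_mul, mul_comm]
      refine mul_le_mul ?_ (hF s) (abs_nonneg _) (by positivity)
      have h1 := abs_sub_le (Q.field J (s j)) (Q.gibbsMean β l J) m
      set z := Q.field J (s j) - Q.gibbsMean β l J
      -- Used in place of Cauchy-Schwarz: the bound stays linear in the variance, whose `β`-integral
      -- is known exactly.
      have h2 : |z| ≤ η + z ^ 2 / η := by
        rw [← sub_le_iff_le_add', le_div_iff₀ hη]
        nlinarith [sq_nonneg (|z| - η), sq_abs z, abs_nonneg z]
      linarith
    refine (replicaMean_mono (Q.weight_nonneg β l J) hpt).trans_eq ?_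
    rw [replicaMean_mul_const, mul_comm, replicaMean_eval (Q.sum_weight β l J) j
      (fun σ => (η + (Q.field J σ - Q.gibbsMean β l J) ^ 2 / η) + |Q.gibbsMean β l J - m|)]
    simp only [add_mul, Finset.sum_add_distrib, ← Finset.mul_sum, sum_weight, mul_one]
    congr 3
    rw [gibbsVar, Finset.sum_div]
    exact Finset.sum_congr rfl fun σ _ => by ring
  have hv : Integrable (fun J => η + Q.gibbsVar β l J / η) Q.law :=
    (integrable_const η).add ((Q.integrable_gibbsVar β l).div_const η)
  rw [e1]
  refine abs_integral_le_integral_abs.trans ?_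
  refine (integral_mono hi1.abs ((hv.add hi2).const_mul A) e2).trans ?_
  simp only [Pi.add_apply]
  rw [integral_const_mul, integral_add hv hi2,
    integral_add (integrable_const η) ((Q.integrable_gibbsVar β l).div_const η), integral_div]
  refine mul_le_mul_of_nonneg_left ?_ hA
  have := Q.integral_abs_gibbsMean_sub_le hy β l
  simp only [integral_const, probReal_univ, one_smul, fluctBound]
  change η + Q.avVar β l / η + _ ≤ _
  linarith

/-- Integration by parts produces the prefactor `β`, needed for the region of small `β`. -/
lemma abs_integral_replicaMean_mul_field_le [DecidableEq ι] {n : ℕ} (β l : ℝ)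
    {F : (Fin n → S) → ℝ} {A : ℝ} (hF : ∀ s, |F s| ≤ A) (j : Fin n) :
    |∫ J, replicaMean (Q.weight β l J) (fun s => F s * Q.field J (s j)) ∂Q.law| ≤
      2 * n * A * Q.totalVar * |β| := by
  have hA : 0 ≤ A := by
    obtain ⟨s⟩ : Nonempty (Fin n → S) := inferInstance
    exact (abs_nonneg _).trans (hF s)
  have hq : ∀ x y : Fin (n + 1), |Q.avReplica β l (fun s : Fin (n + 1) → S =>
      (F fun k => s k.castSucc) * Q.cov (s x) (s y))| ≤ A * Q.totalVar := fun x y =>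
    Q.abs_avReplica_le β l fun s => (abs_mul _ _).trans_le
      (mul_le_mul (hF _) (Q.abs_cov_le _ _) (abs_nonneg _) hA)
  rw [avReplica_mul_field, abs_mul, abs_neg, mul_comm]
  refine mul_le_mul_of_nonneg_right ((abs_sub _ _).trans ?_) (abs_nonneg β)
  have h1 := (Finset.abs_sum_le_sum_abs (fun k : Fin n => Q.avReplica β l
    (fun s : Fin (n + 1) → S => (F fun k => s k.castSucc) *
      Q.cov (s j.castSucc) (s k.castSucc))) Finset.univ).trans
    (Finset.sum_le_sum fun k _ => hq j.castSucc k.castSucc)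
  rw [Finset.sum_const, Finset.card_univ, Fintype.card_fin, nsmul_eq_mul] at h1
  have h2 := mul_le_mul_of_nonneg_left (hq j.castSucc (Fin.last n)) (Nat.cast_nonneg (α := ℝ) n)
  rw [abs_mul, Nat.abs_cast]
  linarith

lemma integral_fluctBound_le [DecidableEq ι] {η y b β₁ β₂ : ℝ} (hη : 0 < η) (hy : 0 < y)
    (hy1 : y ≤ 1) (hβ : β₁ ≤ β₂) (h₁ : |β₁| ≤ b) (h₂ : |β₂| ≤ b) (l : ℝ) :
    ∫ β in β₁..β₂, Q.fluctBound η y β l ≤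
      2 * b * η + 4 * b * Q.totalVar / η + 6 * b * (b + 1) * √Q.totalVar / y +
        8 * y * (b + 1) * Q.totalVar := by
  have hT := Q.totalVar_nonneg
  have hb : 0 ≤ b := (abs_nonneg _).trans h₁
  have hm : ∀ x, |x| ≤ b + 1 → |Q.avMean x l| ≤ 2 * (b + 1) * Q.totalVar := fun x hx =>
    (Q.abs_avMean_le x l).trans (by gcongr)
  have hc : Continuous fun β => Q.avMean β l :=
    Q.continuous_avMean.comp (f := fun β : ℝ => (β, l)) (by fun_prop)
  have hcV : Continuous fun β => Q.avVar β l :=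
    Q.continuous_avVar.comp (f := fun β : ℝ => (β, l)) (by fun_prop)
  have hcs : Continuous fun β => Q.avMean (β - y) l :=
    hc.comp (f := fun β => β - y) (by fun_prop)
  have hca : Continuous fun β => Q.avMean (β + y) l :=
    hc.comp (f := fun β => β + y) (by fun_prop)
  have i1 : ∫ β in β₁..β₂, (η + 3 * (|β| + y) * √Q.totalVar / y) ≤
      2 * b * η + 6 * b * (b + 1) * √Q.totalVar / y := by
    have h : ∫ β in β₁..β₂, (η + 3 * (|β| + y) * √Q.totalVar / y) ≤
        ∫ _ in β₁..β₂, (η + 3 * (b + 1) * √Q.totalVar / y) := by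
      refine intervalIntegral.integral_mono_on hβ
        (Continuous.intervalIntegrable (by fun_prop) _ _) (by simp) fun x hx => ?_
      have : |x| ≤ b := abs_le.2 ⟨(abs_le.1 h₁).1.trans hx.1, hx.2.trans (abs_le.1 h₂).2⟩
      gcongr
    rw [intervalIntegral.integral_const, smul_eq_mul] at h
    have h3 : β₂ - β₁ ≤ 2 * b := by linarith [(abs_le.1 h₁).1, (abs_le.1 h₂).2]
    have h4 : 0 ≤ η + 3 * (b + 1) * √Q.totalVar / y := by positivity
    refine (h.trans (mul_le_mul_of_nonneg_right h3 h4)).trans_eq ?_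
    ring
  have i2 : ∫ β in β₁..β₂, Q.avVar β l / η ≤ 4 * b * Q.totalVar / η := by
    rw [intervalIntegral.integral_div, integral_avVar]
    gcongr
    have k1 := abs_le.1 (Q.abs_avMean_le β₁ l)
    have k2 := abs_le.1 (Q.abs_avMean_le β₂ l)
    have k3 := mul_le_mul_of_nonneg_right h₁ hT
    have k4 := mul_le_mul_of_nonneg_right h₂ hT
    linarith
  have i3 : ∫ β in β₁..β₂, (Q.avMean (β - y) l - Q.avMean (β + y) l) ≤
      8 * y * (b + 1) * Q.totalVar := by
    have hI : ∀ x z, IntervalIntegrable (fun β => Q.avMean β l) volume x z :=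
      fun x z => hc.intervalIntegrable x z
    -- The shifted integrals cancel except on windows of width `2 * y` around `β₁` and `β₂`; since
    -- `y ≤ 1`, these stay where `|x| ≤ b + 1`.
    rw [intervalIntegral.integral_sub (hcs.intervalIntegrable _ _)
      (hca.intervalIntegrable _ _),
      intervalIntegral.integral_comp_sub_right (fun β => Q.avMean β l),
      intervalIntegral.integral_comp_add_right (fun β => Q.avMean β l),
      intervalIntegral.integral_interval_sub_interval_comm (hI _ _) (hI _ _) (hI _ _)]
    have hw : ∀ x, |x| ≤ b → |∫ β in (x - y)..(x + y), Q.avMean β l| ≤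
        2 * (b + 1) * Q.totalVar * (2 * y) := by
      intro x hx
      refine (intervalIntegral.norm_integral_le_of_norm_le_const
        (f := fun β => Q.avMean β l) (C := 2 * (b + 1) * Q.totalVar) fun z hz => hm z ?_).trans_eq ?_
      · rw [Set.uIoc_of_le (by linarith)] at hz
        have := abs_le.1 hx
        exact abs_le.2 ⟨by linarith [hz.1], by linarith [hz.2]⟩
      · rw [add_sub_sub_cancel, ← two_mul, abs_of_pos (by positivity)]
    have k1 := abs_le.1 (hw β₁ h₁)
    have k2 := abs_le.1 (hw β₂ h₂)
    linarith
  have hs : ∀ β, Q.fluctBound η y β l = (η + 3 * (|β| + y) * √Q.totalVar / y) +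
      Q.avVar β l / η + (Q.avMean (β - y) l - Q.avMean (β + y) l) := fun β => by
    rw [fluctBound]; ring
  simp only [hs]
  rw [intervalIntegral.integral_add, intervalIntegral.integral_add]
  · linarith
  · exact Continuous.intervalIntegrable (by fun_prop) _ _
  · exact Continuous.intervalIntegrable (by fun_prop) _ _
  · exact Continuous.intervalIntegrable (by fun_prop) _ _
  · exact (hcs.sub hca).intervalIntegrable _ _

end GaussianSystem

end

/-! ### Passing from fixed `l` to fixed `μ` in integrals over rectangles. -/

section RectangleIntegrals

/-- A nonnegative `f` that is not integrable has integral zero by convention, so no regularity of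
`f` is needed, and later none of `g₁` or `g₂`. -/
lemma intervalIntegral_mono_of_nonneg {f g : ℝ → ℝ} {a b : ℝ} (hab : a ≤ b) (hf : ∀ x, 0 ≤ f x)
    (hg : Continuous g) (h : ∀ x ∈ Set.Icc a b, f x ≤ g x) :
    ∫ x in a..b, f x ≤ ∫ x in a..b, g x := by
  rw [intervalIntegral.integral_of_le hab, intervalIntegral.integral_of_le hab]
  exact integral_mono_of_nonneg (Eventually.of_forall hf) ((hg.intervalIntegrable a b).1)
    (ae_restrict_of_forall_mem measurableSet_Ioc fun x hx => h x ⟨hx.1.le, hx.2⟩)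

lemma integral_integral_swap_of_continuous {f : ℝ → ℝ → ℝ} (hf : Continuous (Function.uncurry f))
    (a b c d : ℝ) :
    ∫ x in a..b, ∫ y in c..d, f x y = ∫ y in c..d, ∫ x in a..b, f x y := by
  refine intervalIntegral_intervalIntegral_swap ?_
  exact (hf.continuousOn.integrableOn_compact (isCompact_uIcc.prod isCompact_uIcc)).mono_set
    (Set.prod_mono Set.uIoc_subset_uIcc Set.uIoc_subset_uIcc)

/-- Change of variables `l = β * μ` in an integral over a rectangle. -/
lemma integral_integral_abs_mul_le {Φ : ℝ × ℝ → ℝ} (hΦ : Continuous Φ) (h0 : ∀ q, 0 ≤ Φ q)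
    {β₁ β₂ μ₁ μ₂ b c δ : ℝ} (hβ : β₁ ≤ β₂) (hμ : μ₁ ≤ μ₂) (hβ₁ : |β₁| ≤ b) (hβ₂ : |β₂| ≤ b)
    (hμ₁ : |μ₁| ≤ c) (hμ₂ : |μ₂| ≤ c) (hδ : ∀ l, ∫ β in β₁..β₂, Φ (β, l) ≤ δ) :
    ∫ μ in μ₁..μ₂, ∫ β in β₁..β₂, |β| * Φ (β, β * μ) ≤ 2 * b * c * δ := by
  have hb : 0 ≤ b := (abs_nonneg _).trans hβ₁
  have hc : 0 ≤ c := (abs_nonneg _).trans hμ₁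
  have hbc : -(b * c) ≤ b * c := by have := mul_nonneg hb hc; linarith
  rw [integral_integral_swap_of_continuous (f := fun μ β => |β| * Φ (β, β * μ)) (by fun_prop)]
  have hpt : ∀ β ∈ Set.Icc β₁ β₂, ∫ μ in μ₁..μ₂, |β| * Φ (β, β * μ) ≤
      ∫ l in (-(b * c))..(b * c), Φ (β, l) := by
    intro β h
    have hβb : |β| ≤ b := abs_le.2 ⟨(abs_le.1 hβ₁).1.trans h.1, h.2.trans (abs_le.1 hβ₂).2⟩
    have hI : 0 ≤ ∫ μ in μ₁..μ₂, Φ (β, β * μ) :=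
      intervalIntegral.integral_nonneg hμ fun μ _ => h0 _
    have hr : ∀ μ, |μ| ≤ c → -(b * c) ≤ β * μ ∧ β * μ ≤ b * c := fun μ h' =>
      abs_le.1 ((abs_mul β μ).trans_le (mul_le_mul hβb h' (abs_nonneg _) hb))
    -- The factor `|β|` is the Jacobian of `l = β * μ`. Absolute values absorb the reversed
    -- orientation when `β < 0`, and the case `β = 0` needs no separate treatment.
    rw [intervalIntegral.integral_const_mul, ← abs_of_nonneg hI, ← abs_mul,
      intervalIntegral.mul_integral_comp_mul_left (f := fun l => Φ (β, l))]
    rw [← abs_of_nonneg (intervalIntegral.integral_nonneg hbc fun l _ => h0 (β, l))]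
    refine intervalIntegral.abs_integral_mono_interval ?_ (Eventually.of_forall fun l => h0 _)
      (Continuous.intervalIntegrable (by fun_prop) _ _)
    rw [Set.uIoc_of_le hbc, Set.uIoc]
    exact Set.Ioc_subset_Ioc (le_min (hr _ hμ₁).1 (hr _ hμ₂).1)
      (max_le (hr _ hμ₁).2 (hr _ hμ₂).2)
  refine (intervalIntegral_mono_of_nonneg hβ (fun β => intervalIntegral.integral_nonneg hμ
    fun μ _ => mul_nonneg (abs_nonneg _) (h0 _)) ?_ hpt).trans ?_
  · exact intervalIntegral.continuous_parametric_intervalIntegral_of_continuous' (by fun_prop) _ _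
  rw [integral_integral_swap_of_continuous (f := fun β l => Φ (β, l)) hΦ]
  refine (intervalIntegral_mono_of_nonneg hbc (fun l => intervalIntegral.integral_nonneg hβ
    fun β _ => h0 _) (g := fun _ => δ) continuous_const fun l _ => hδ l).trans_eq ?_
  rw [intervalIntegral.integral_const, smul_eq_mul]
  ring

/-- The missing Jacobian is inserted by `1 ≤ |β| / ε` when `|β| ≥ ε`; for smaller `|β|` the bound
`C₁ * |β|` takes over. Adding the two bounds avoids splitting the domain. -/
lemma integral_integral_abs_le {Φ : ℝ × ℝ → ℝ} (hΦ : Continuous Φ) (h0 : ∀ q, 0 ≤ Φ q)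
    {β₁ β₂ μ₁ μ₂ b c δ : ℝ} (hβ : β₁ ≤ β₂) (hμ : μ₁ ≤ μ₂) (hβ₁ : |β₁| ≤ b) (hβ₂ : |β₂| ≤ b)
    (hμ₁ : |μ₁| ≤ c) (hμ₂ : |μ₂| ≤ c) (hδ : ∀ l, ∫ β in β₁..β₂, Φ (β, l) ≤ δ)
    {g : ℝ → ℝ → ℝ} {C₁ C₂ ε : ℝ} (hC₁ : 0 ≤ C₁) (hC₂ : 0 ≤ C₂) (hε : 0 < ε)
    (hg₁ : ∀ β, ∀ μ ∈ Set.Icc μ₁ μ₂, |g β μ| ≤ C₁ * |β|)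
    (hg₂ : ∀ β, ∀ μ ∈ Set.Icc μ₁ μ₂, |g β μ| ≤ C₂ * Φ (β, β * μ)) :
    ∫ μ in μ₁..μ₂, ∫ β in β₁..β₂, |g β μ| ≤
      4 * b * c * C₁ * ε + 2 * b * c * C₂ * δ / ε := by
  have hb : 0 ≤ b := (abs_nonneg _).trans hβ₁
  have hc : 0 ≤ c := (abs_nonneg _).trans hμ₁
  have hpt : ∀ β, ∀ μ ∈ Set.Icc μ₁ μ₂,
      |g β μ| ≤ C₁ * ε + C₂ / ε * (|β| * Φ (β, β * μ)) := by
    intro β μ hμ'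
    have hn : 0 ≤ C₂ / ε * (|β| * Φ (β, β * μ)) := by have := h0 (β, β * μ); positivity
    rcases le_total |β| ε with h | h
    · have := mul_le_mul_of_nonneg_left h hC₁
      linarith [hg₁ β μ hμ']
    · have h1 : C₂ * Φ (β, β * μ) ≤ C₂ / ε * (|β| * Φ (β, β * μ)) := by
        rw [div_mul_eq_mul_div, le_div_iff₀ hε]
        have := mul_le_mul_of_nonneg_left h (mul_nonneg hC₂ (h0 (β, β * μ)))
        linarith
      have := mul_nonneg hC₁ hε.le
      linarith [hg₂ β μ hμ']
  have hcont : Continuous fun μ => ∫ β in β₁..β₂, |β| * Φ (β, β * μ) :=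
    intervalIntegral.continuous_parametric_intervalIntegral_of_continuous' (by fun_prop) _ _
  have h1 : ∫ μ in μ₁..μ₂, ∫ β in β₁..β₂, |g β μ| ≤
      ∫ μ in μ₁..μ₂, ((β₂ - β₁) * (C₁ * ε) +
        C₂ / ε * ∫ β in β₁..β₂, |β| * Φ (β, β * μ)) := by
    refine intervalIntegral_mono_of_nonneg hμ (fun μ => intervalIntegral.integral_nonneg hβ
      fun β _ => abs_nonneg _) (by fun_prop) fun μ hμ' => ?_
    refine (intervalIntegral_mono_of_nonneg hβ (fun β => abs_nonneg _)
      (g := fun β => C₁ * ε + C₂ / ε * (|β| * Φ (β, β * μ))) (by fun_prop)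
      fun β _ => hpt β μ hμ').trans_eq ?_
    rw [intervalIntegral.integral_add (by simp) (Continuous.intervalIntegrable (by fun_prop) _ _),
      intervalIntegral.integral_const, intervalIntegral.integral_const_mul, smul_eq_mul]
  rw [intervalIntegral.integral_add (by simp) (Continuous.intervalIntegrable (by fun_prop) _ _),
    intervalIntegral.integral_const, intervalIntegral.integral_const_mul, smul_eq_mul] at h1
  have h2 := mul_le_mul_of_nonneg_left
    (integral_integral_abs_mul_le hΦ h0 hβ hμ hβ₁ hβ₂ hμ₁ hμ₂ hδ) (div_nonneg hC₂ hε.le)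
  have h3 : β₂ - β₁ ≤ 2 * b := by linarith [(abs_le.1 hβ₁).1, (abs_le.1 hβ₂).2]
  have h4 : μ₂ - μ₁ ≤ 2 * c := by linarith [(abs_le.1 hμ₁).1, (abs_le.1 hμ₂).2]
  have h5 : (μ₂ - μ₁) * ((β₂ - β₁) * (C₁ * ε)) ≤ (2 * c) * ((2 * b) * (C₁ * ε)) := by
    have := mul_nonneg hC₁ hε.le
    have : 0 ≤ β₂ - β₁ := by linarith
    gcongr
  refine h1.trans ((add_le_add h5 h2).trans_eq ?_)
  ring

end RectangleIntegrals

/-! ### The spin glass as a Gaussian system; `g₁` and `g₂` as energy correlations. -/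

noncomputable section

namespace SpinGlass

variable {d : ℕ}

lemma abs_spin_le_one {Λ : Box d} (σ : Config Λ) (X : Finset Λ.1) : |spin σ X| ≤ 1 := by
  unfold spin
  split_ifs
  · simp
  · rw [Finset.abs_prod]
    refine Finset.prod_le_one (fun _ _ => abs_nonneg _) fun i _ => ?_
    rcases Int.units_eq_one_or (σ i) with h | h <;> simp [h]

lemma spin_mul_self {Λ : Box d} (σ : Config Λ) (X : Finset Λ.1) :
    spin σ X * spin σ X = if X = ∅ then 0 else 1 := by
  unfold spin
  split_ifs
  · simp
  · rw [← Finset.prod_mul_distrib]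
    refine Finset.prod_eq_one fun i _ => ?_
    rcases Int.units_eq_one_or (σ i) with h | h <;> simp [h]

lemma one_le_vol (Λ : Box d) : 1 ≤ vol Λ := by
  obtain ⟨Λ, a, b, hab, rfl⟩ := Λ
  have : 0 < (Finset.Icc a b).card := Finset.card_pos.2 (Finset.nonempty_Icc.2 hab)
  change (1 : ℝ) ≤ ((Finset.Icc a b).card : ℝ)
  exact_mod_cast this

lemma vol_pos (Λ : Box d) : 0 < vol Λ := zero_lt_one.trans_le (one_le_vol Λ)

lemma tendsto_vol_atTop (hd : 1 ≤ d) : Tendsto (fun Λ : Box d => vol Λ) atTop atTop := by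
  refine tendsto_atTop.2 fun x => ?_
  obtain ⟨n, hn⟩ := exists_nat_ge x
  have h0 : (0 : Fin d → ℤ) ≤ fun _ => (n : ℤ) := fun _ => by simp
  let Λ₀ : Box d := ⟨Finset.Icc 0 fun _ => (n : ℤ), 0, _, h0, rfl⟩
  filter_upwards [eventually_ge_atTop Λ₀] with Λ hΛ
  have h1 : vol Λ₀ ≤ vol Λ := by
    unfold vol; exact_mod_cast Finset.card_le_card hΛ
  have h2 : (n : ℝ) ≤ vol Λ₀ := by
    unfold vol
    have : n ≤ Λ₀.1.card := by
      change n ≤ (Finset.Icc (0 : Fin d → ℤ) fun _ => (n : ℤ)).card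
      rw [Pi.card_Icc]
      simp only [Pi.zero_apply, Int.card_Icc, sub_zero, Finset.prod_const, Finset.card_univ,
        Fintype.card_fin]
      have e : ((n : ℤ) + 1).toNat = n + 1 := by omega
      rw [e]
      -- Here `1 ≤ d` enters: in dimension zero the volume stays equal to 1.
      exact (Nat.le_succ n).trans (Nat.le_self_pow (by omega) _)
    exact_mod_cast this
  linarith

namespace Model

variable (M : Model d) (Λ : Box d)

/-- The spin glass in the volume `Λ` as a Gaussian system. -/
def system : GaussianSystem (Finset Λ.1) (Config Λ) where
  coeff σ X := -spin σ X
  abs_coeff_le σ X := (abs_neg _).trans_le (abs_spin_le_one σ X)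
  drift σ := -∑ X, M.mean Λ X * spin σ X
  var X := M.dev Λ X ^ 2

lemma expo_system (β μ : ℝ) (J : Finset Λ.1 → ℝ) (σ : Config Λ) :
    (M.system Λ).expo β (β * μ) J σ = -β * M.hamiltonian Λ μ J σ := by
  simp only [GaussianSystem.expo, GaussianSystem.field, system, hamiltonian, add_mul,
    Finset.sum_add_distrib, mul_neg, Finset.sum_neg_distrib, mul_assoc, ← Finset.mul_sum]
  ring

lemma gibbs_eq_replicaMean (β μ : ℝ) (J : Finset Λ.1 → ℝ) {n : ℕ}
    (F : (Fin n → Config Λ) → ℝ) :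
    M.gibbs Λ β μ J F = replicaMean ((M.system Λ).weight β (β * μ) J) F := by
  refine Finset.sum_congr rfl fun s _ => ?_
  simp only [GaussianSystem.weight, softmax_eq_div, Finset.prod_div_distrib, expo_system,
    Finset.prod_const, Finset.card_univ, Fintype.card_fin, ← Real.exp_sum, ← Finset.mul_sum]
  rfl

lemma quenched_eq_avReplica (β μ : ℝ) {n : ℕ} (F : (Fin n → Config Λ) → ℝ) :
    M.quenched Λ β μ F = (M.system Λ).avReplica β (β * μ) F := by
  simp only [quenched, av, gibbs_eq_replicaMean]
  rfl

lemma c_eq_cov (μ : ℝ) (σ τ : Config Λ) :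
    M.c Λ μ σ τ = (M.system Λ).cov σ τ * (vol Λ)⁻¹ := by
  rw [c, covH_eq, GaussianSystem.cov, mul_comm, one_div]
  simp [system]

lemma c_comm (μ : ℝ) (σ τ : Config Λ) : M.c Λ μ σ τ = M.c Λ μ τ σ := by
  simp only [c_eq_cov, GaussianSystem.cov, mul_right_comm]

/-- The square of `spin σ X` does not depend on `σ`. Constant self-overlaps are what makes the
diagonal terms cancel in `g₁`. -/
lemma c_self (μ : ℝ) (σ τ : Config Λ) : M.c Λ μ σ σ = M.c Λ μ τ τ := by
  simp only [c, covH_eq, mul_assoc, spin_mul_self]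

variable {R : ℕ} (G : (Fin R → ℝ) × (Fin R → Fin R → ℝ) → ℝ)

lemma avGq_comm (β μ : ℝ) (k l : Fin (R + 2)) : M.avGq Λ G β μ k l = M.avGq Λ G β μ l k := by
  simp only [avGq, M.c_comm Λ μ _ _]

lemma avGq_self (β μ : ℝ) (k l : Fin (R + 2)) : M.avGq Λ G β μ k k = M.avGq Λ G β μ l l := by
  unfold avGq
  congr 1
  funext s
  rw [M.c_self Λ μ (s k) (s l)]

/-- Replicas `R + 1` and `R + 2` do not enter `G`, so exchanging them is a symmetry. -/
lemma avGq_repB (β μ : ℝ) (k : Fin R) :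
    M.avGq Λ G β μ (rep k) (repB R) = M.avGq Λ G β μ (rep k) (repA R) := by
  have hk : ∀ k : Fin R, Equiv.swap (repA R) (repB R) (rep k) = rep k := fun k =>
    Equiv.swap_apply_of_ne_of_ne
      (by simp [rep, repA, Fin.ext_iff]; omega) (by simp [rep, repB, Fin.ext_iff]; omega)
  rw [avGq, avGq, quenched_eq_avReplica, quenched_eq_avReplica,
    ← GaussianSystem.avReplica_comp_perm _ _ _ (Equiv.swap (repA R) (repB R))]
  simp only [Function.comp_apply, hk, Equiv.swap_apply_right]

/-- The observable `G` as a function of `R + 1` replicas. -/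
def observableSucc (μ : ℝ) (s : Fin (R + 1) → Config Λ) : ℝ :=
  M.observable Λ μ G fun j => s j.castSucc

/-- `<G k> - <G> <k>` for the Gaussian energy density `k` of the replica `j`. -/
def energyCov (β μ : ℝ) (j : Fin (R + 1)) : ℝ :=
  (vol Λ)⁻¹ * (∫ J, replicaMean ((M.system Λ).weight β (β * μ) J)
      (fun s => M.observableSucc Λ G μ s * (M.system Λ).field J (s j)) ∂(M.system Λ).law -
    (M.system Λ).avReplica β (β * μ) (M.observableSucc Λ G μ) *
      (M.system Λ).avMean β (β * μ))

lemma avGq_eq (β μ : ℝ) (k l : Fin (R + 2)) :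
    M.avGq Λ G β μ k l = (M.system Λ).avReplica β (β * μ) (fun s : Fin (R + 1 + 1) → Config Λ =>
      M.observableSucc Λ G μ (fun j => s j.castSucc) * (M.system Λ).cov (s k) (s l)) *
        (vol Λ)⁻¹ := by
  rw [avGq, quenched_eq_avReplica, ← GaussianSystem.avReplica_mul_const]
  simp only [c_eq_cov, mul_assoc]
  rfl

/-- Integration by parts with `n = R + 1` replicas: the new one is replica `R + 2`, and `n` is the
coefficient of its overlap. -/
lemma energyCov_eq (β μ : ℝ) (j : Fin (R + 1)) :
    M.energyCov Λ G β μ j =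
      -β * (∑ k : Fin R, M.avGq Λ G β μ j.castSucc (rep k) + M.avGq Λ G β μ j.castSucc (repA R)
        - (R + 1) * M.avGq Λ G β μ j.castSucc (repB R)
        - M.quenched Λ β μ (n := R) (M.observable Λ μ G) *
        (M.quenched Λ β μ (n := 1) (fun s => M.c Λ μ (s 0) (s 0))
          - M.quenched Λ β μ (n := 2) (fun s => M.c Λ μ (s 0) (s 1)))) := by
  have h0 : M.quenched Λ β μ (n := R) (M.observable Λ μ G) =
      (M.system Λ).avReplica β (β * μ) (M.observableSucc Λ G μ) := by
    rw [quenched_eq_avReplica]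
    exact ((M.system Λ).avReplica_castSucc β (β * μ) (M.observable Λ μ G)).symm
  have h1 : M.quenched Λ β μ (n := 1) (fun s => M.c Λ μ (s 0) (s 0)) =
      (M.system Λ).avReplica β (β * μ)
        (fun s : Fin 2 → Config Λ => (M.system Λ).cov (s 0) (s 0)) * (vol Λ)⁻¹ := by
    rw [quenched_eq_avReplica]
    simp only [c_eq_cov, GaussianSystem.avReplica_mul_const]
    congr 1
    exact ((M.system Λ).avReplica_castSucc β (β * μ)
      (fun s : Fin 1 → Config Λ => (M.system Λ).cov (s 0) (s 0))).symm
  have h2 : M.quenched Λ β μ (n := 2) (fun s => M.c Λ μ (s 0) (s 1)) =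
      (M.system Λ).avReplica β (β * μ)
        (fun s : Fin 2 → Config Λ => (M.system Λ).cov (s 0) (s 1)) * (vol Λ)⁻¹ := by
    rw [quenched_eq_avReplica]
    simp only [c_eq_cov, GaussianSystem.avReplica_mul_const]
  have h3 : ∀ k : Fin R, rep k = (k.castSucc : Fin (R + 1)).castSucc := fun k => rfl
  have h4 : repA R = (Fin.last R).castSucc := rfl
  have h5 : repB R = Fin.last (R + 1) := rfl
  rw [energyCov, GaussianSystem.avReplica_mul_field, GaussianSystem.avMean_eq,
    Fin.sum_univ_castSucc, h0, h1, h2]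
  simp only [h3, h4, h5, avGq_eq, ← Finset.sum_mul]
  push_cast
  ring

lemma g₂_eq_energyCov (β μ : ℝ) : M.g₂ Λ G β μ = M.energyCov Λ G β μ (Fin.last R) := by
  have h4 : (Fin.last R).castSucc = repA R := rfl
  rw [energyCov_eq, g₂, h4]
  simp only [M.avGq_comm Λ G β μ (repA R) (rep _)]

/-- In each difference the product of averages drops out; the `R` diagonal overlaps cancel against
the self-overlap of replica `R + 1`. -/
lemma g₁_eq_sum_energyCov (β μ : ℝ) : M.g₁ Λ G β μ =
    ∑ k : Fin R, (M.energyCov Λ G β μ k.castSucc - M.energyCov Λ G β μ (Fin.last R)) := by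
  have h4 : (Fin.last R).castSucc = repA R := rfl
  have h3 : ∀ k : Fin R, (k.castSucc : Fin (R + 1)).castSucc = rep k := fun k => rfl
  have hsplit : ∑ k : Fin R, ∑ l : Fin R, M.avGq Λ G β μ (rep k) (rep l) =
      (∑ k : Fin R, ∑ l : Fin R, if k ≠ l then M.avGq Λ G β μ (rep l) (rep k) else 0) +
        R * M.avGq Λ G β μ (repA R) (repA R) := by
    have : ∀ k : Fin R, ∑ l : Fin R, M.avGq Λ G β μ (rep k) (rep l) =
        (∑ l : Fin R, if k ≠ l then M.avGq Λ G β μ (rep l) (rep k) else 0) +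
          M.avGq Λ G β μ (repA R) (repA R) := by
      intro k
      rw [M.avGq_self Λ G β μ (repA R) (rep k)]
      have h : M.avGq Λ G β μ (rep k) (rep k) =
          ∑ l : Fin R, if k = l then M.avGq Λ G β μ (rep k) (rep k) else 0 := by simp
      rw [h, ← Finset.sum_add_distrib]
      refine Finset.sum_congr rfl fun l _ => ?_
      by_cases hkl : k = l
      · subst hkl; simp
      · simp [hkl, M.avGq_comm Λ G β μ (rep l) (rep k)]
    simp only [this, Finset.sum_add_distrib]
    simp
  simp only [energyCov_eq, h3, h4, avGq_repB, M.avGq_comm Λ G β μ (repA R) (rep _), g₁,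
    Finset.sum_sub_distrib, ← Finset.mul_sum, Finset.sum_add_distrib, hsplit, Finset.sum_const,
    Finset.card_univ, Fintype.card_fin, nsmul_eq_mul]
  ring

end Model

end SpinGlass

end

/-! ### Estimates uniform in the volume, and the limit. -/

noncomputable section

namespace SpinGlass

namespace Model

variable {d : ℕ} (M : Model d) (Λ : Box d) {R : ℕ} (G : (Fin R → ℝ) × (Fin R → Fin R → ℝ) → ℝ)

/-- Thermodynamic stability with the constant `C`. -/
def StableWith (C : ℝ) : Prop :=
  ∀ Λ : Box d, (1 / vol Λ) * ∑ X : Finset Λ.1, |M.mean Λ X| ≤ C ∧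
    (1 / vol Λ) * ∑ X : Finset Λ.1, (M.dev Λ X : ℝ) ^ 2 ≤ C

variable {M} {C : ℝ}

lemma StableWith.nonneg (hM : M.StableWith C) : 0 ≤ C := by
  let Λ : Box d := ⟨Finset.Icc 0 0, 0, 0, le_rfl, rfl⟩
  refine le_trans ?_ (hM Λ).1
  have := (vol_pos Λ).le
  positivity

lemma StableWith.totalVar_le (hM : M.StableWith C) (Λ : Box d) :
    (M.system Λ).totalVar ≤ C * vol Λ := by
  have h := (hM Λ).2
  rw [one_div, inv_mul_le_iff₀ (vol_pos Λ)] at h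
  simpa [GaussianSystem.totalVar, system, mul_comm] using h

lemma StableWith.abs_b_le (hM : M.StableWith C) (Λ : Box d) (μ : ℝ) (σ : Config Λ) :
    |M.b Λ μ σ| ≤ |μ| * C := by
  have h := (hM Λ).1
  rw [one_div, inv_mul_le_iff₀ (vol_pos Λ)] at h
  rw [b, meanH_eq, abs_mul, abs_neg, one_div, abs_inv, abs_of_pos (vol_pos Λ),
    inv_mul_le_iff₀ (vol_pos Λ)]
  calc |∑ X, μ * M.mean Λ X * spin σ X| ≤ ∑ X, |μ| * |M.mean Λ X| := by
        refine (Finset.abs_sum_le_sum_abs _ _).trans (Finset.sum_le_sum fun X _ => ?_)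
        rw [abs_mul, abs_mul]
        exact mul_le_of_le_one_right (by positivity) (abs_spin_le_one σ X)
    _ ≤ |μ| * (vol Λ * C) := by
        rw [← Finset.mul_sum]; exact mul_le_mul_of_nonneg_left h (abs_nonneg μ)
    _ = vol Λ * (|μ| * C) := by ring

lemma StableWith.abs_c_le (hM : M.StableWith C) (Λ : Box d) (μ : ℝ) (σ τ : Config Λ) :
    |M.c Λ μ σ τ| ≤ C := by
  rw [c_eq_cov, abs_mul, abs_inv, abs_of_pos (vol_pos Λ), ← div_eq_mul_inv,
    div_le_iff₀ (vol_pos Λ)]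
  exact ((M.system Λ).abs_cov_le σ τ).trans (hM.totalVar_le Λ)

/-- Stability confines the arguments of `G` to a ball that does not depend on `Λ`, and `G` is
bounded there by compactness. -/
lemma StableWith.exists_abs_observable_le (hM : M.StableWith C) (hG : Continuous G) (m : ℝ) :
    ∃ A : ℝ, ∀ (Λ : Box d) (μ : ℝ), |μ| ≤ m → ∀ s : Fin R → Config Λ,
      |M.observable Λ μ G s| ≤ A := by
  have hC := hM.nonneg
  obtain ⟨A, hA⟩ := (isCompact_closedBall (0 : (Fin R → ℝ) × (Fin R → Fin R → ℝ))
    (max (m * C) C)).exists_bound_of_continuousOn hG.continuousOn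
  refine ⟨A, fun Λ μ hμ s => hA _ ?_⟩
  have hr : 0 ≤ max (m * C) C := hC.trans (le_max_right _ _)
  rw [mem_closedBall_zero_iff, Prod.norm_def, max_le_iff, pi_norm_le_iff_of_nonneg hr,
    pi_norm_le_iff_of_nonneg hr]
  refine ⟨fun k => ?_, fun k => (pi_norm_le_iff_of_nonneg hr).2 fun l => ?_⟩
  · exact (hM.abs_b_le Λ μ (s k)).trans
      ((mul_le_mul_of_nonneg_right hμ hC).trans (le_max_left _ _))
  · exact (hM.abs_c_le Λ μ (s k) (s l)).trans (le_max_right _ _)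

variable {G} {A β μ : ℝ}

lemma StableWith.abs_energyCov_le (hM : M.StableWith C)
    (hA : ∀ s, |M.observable Λ μ G s| ≤ A) (j : Fin (R + 1)) :
    |M.energyCov Λ G β μ j| ≤ (2 * (R + 1) * A * C + 2 * A * C) * |β| := by
  have hA0 : 0 ≤ A := (abs_nonneg _).trans (hA fun _ _ => 1)
  have hT := hM.totalVar_le Λ
  have h1 := (M.system Λ).abs_integral_replicaMean_mul_field_le β (β * μ)
    (F := M.observableSucc Λ G μ) (fun s => hA _) j
  have h2 := (M.system Λ).abs_avReplica_le β (β * μ)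
    (F := M.observableSucc Λ G μ) (fun s => hA _)
  have h3 := (M.system Λ).abs_avMean_le β (β * μ)
  rw [energyCov, abs_mul, abs_inv, abs_of_pos (vol_pos Λ), inv_mul_le_iff₀ (vol_pos Λ)]
  refine (abs_sub _ _).trans ?_
  rw [abs_mul]
  have h4 := mul_le_mul h2 h3 (abs_nonneg _) hA0
  have h5 : 0 ≤ 2 * (R + 1) * A * |β| + 2 * A * |β| := by positivity
  have h6 := mul_le_mul_of_nonneg_left hT h5
  push_cast at h1
  linarith

lemma abs_energyCov_le_fluctBound (hA : ∀ s, |M.observable Λ μ G s| ≤ A) (j : Fin (R + 1))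
    {η y : ℝ} (hη : 0 < η) (hy : 0 < y) :
    |M.energyCov Λ G β μ j| ≤ A * ((M.system Λ).fluctBound η y β (β * μ) / vol Λ) := by
  rw [energyCov, abs_mul, abs_inv, abs_of_pos (vol_pos Λ), inv_mul_le_iff₀ (vol_pos Λ)]
  refine ((M.system Λ).abs_integral_replicaMean_mul_field_sub_le hη hy β (β * μ)
    (F := M.observableSucc Λ G μ) (fun s => hA _) j).trans_eq ?_
  have := (vol_pos Λ).ne'
  field_simp

lemma abs_g₁_le {B : ℝ} (h : ∀ j, |M.energyCov Λ G β μ j| ≤ B) :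
    |M.g₁ Λ G β μ| ≤ 2 * R * B := by
  rw [g₁_eq_sum_energyCov]
  refine (Finset.abs_sum_le_sum_abs _ _).trans ?_
  refine (Finset.sum_le_sum fun k _ =>
    (abs_sub _ _).trans (add_le_add (h k.castSucc) (h (Fin.last R)))).trans_eq ?_
  simp
  ring

/-- With `t = |Λ|^(-1/8)`, the choices `η = |Λ| * t ^ 2` and `y = t ^ 2` make the `η` term, the free
energy term and the window term each of order `t ^ 2` per unit volume; the variance term is of order
`t ^ 6`. -/
lemma StableWith.integral_fluctBound_div_vol_le (hM : M.StableWith C) {t b β₁ β₂ : ℝ}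
    (ht : 0 < t) (ht1 : t ≤ 1) (htv : t ^ 8 * vol Λ = 1) (hβ : β₁ ≤ β₂) (h₁ : |β₁| ≤ b)
    (h₂ : |β₂| ≤ b) (l : ℝ) :
    ∫ β in β₁..β₂, (M.system Λ).fluctBound (vol Λ * t ^ 2) (t ^ 2) β l / vol Λ ≤
      (2 * b + 4 * b * C + 6 * b * (b + 1) * √C + 8 * (b + 1) * C) * t ^ 2 := by
  have hv := vol_pos Λ
  have hC := hM.nonneg
  have hb : 0 ≤ b := (abs_nonneg _).trans h₁
  have hT := hM.totalVar_le Λ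
  have hsq : √(M.system Λ).totalVar ≤ √C * (t ^ 4 * vol Λ) := by
    refine Real.sqrt_le_iff.2 ⟨by positivity, hT.trans_eq ?_⟩
    rw [mul_pow, Real.sq_sqrt hC]
    linear_combination (-C * vol Λ) * htv
  have h := (M.system Λ).integral_fluctBound_le (η := vol Λ * t ^ 2) (y := t ^ 2) (by positivity)
    (by positivity) (pow_le_one₀ ht.le ht1) hβ h₁ h₂ l
  rw [intervalIntegral.integral_div, div_le_iff₀ hv]
  refine h.trans ?_
  have e1 : 4 * b * (M.system Λ).totalVar / (vol Λ * t ^ 2) ≤ 4 * b * C * t ^ 2 * vol Λ := by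
    rw [div_le_iff₀ (by positivity)]
    have h1 : 1 ≤ t ^ 4 * vol Λ :=
      htv ▸ mul_le_mul_of_nonneg_right (pow_le_pow_of_le_one ht.le ht1 (by norm_num)) hv.le
    have h2 : (M.system Λ).totalVar ≤ C * vol Λ * (t ^ 4 * vol Λ) :=
      hT.trans (le_mul_of_one_le_right (by positivity) h1)
    refine (mul_le_mul_of_nonneg_left h2 (by positivity)).trans_eq (by ring)
  have e2 : 6 * b * (b + 1) * √(M.system Λ).totalVar / t ^ 2 ≤
      6 * b * (b + 1) * √C * t ^ 2 * vol Λ := by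
    rw [div_le_iff₀ (by positivity)]
    refine (mul_le_mul_of_nonneg_left hsq (by positivity)).trans_eq (by ring)
  have e3 := mul_le_mul_of_nonneg_left hT (show 0 ≤ 8 * t ^ 2 * (b + 1) by positivity)
  linarith

lemma StableWith.exists_integral_abs_le (hM : M.StableWith C) (hG : Continuous G)
    {β₁ β₂ μ₁ μ₂ : ℝ} (hβ : β₁ ≤ β₂) (hμ : μ₁ ≤ μ₂) :
    ∃ D : ℝ, ∀ (Λ : Box d) (t : ℝ), 0 < t → t ≤ 1 → t ^ 8 * vol Λ = 1 →
      ∫ μ in μ₁..μ₂, ∫ β in β₁..β₂, |M.g₁ Λ G β μ| ≤ 2 * R * D * t ∧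
      ∫ μ in μ₁..μ₂, ∫ β in β₁..β₂, |M.g₂ Λ G β μ| ≤ D * t := by
  set b := max |β₁| |β₂|
  set m := max |μ₁| |μ₂|
  obtain ⟨A, hA⟩ := hM.exists_abs_observable_le G hG m
  set C₁ := 2 * (R + 1) * A * C + 2 * A * C
  set C₃ := 2 * b + 4 * b * C + 6 * b * (b + 1) * √C + 8 * (b + 1) * C
  refine ⟨4 * b * m * C₁ + 2 * b * m * A * C₃, fun Λ t ht ht1 htv => ?_⟩
  have hv := vol_pos Λ
  have hη : 0 < vol Λ * t ^ 2 := by positivity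
  have hy : 0 < t ^ 2 := by positivity
  have hC := hM.nonneg
  have hμm : ∀ μ ∈ Set.Icc μ₁ μ₂, |μ| ≤ m := fun μ h => abs_le_max_abs_abs h.1 h.2
  have hA0 : 0 ≤ A :=
    (abs_nonneg _).trans (hA Λ μ₁ (hμm μ₁ ⟨le_rfl, hμ⟩) fun _ _ => 1)
  have hC₁ : 0 ≤ C₁ := by positivity
  have hE₁ : ∀ β, ∀ μ ∈ Set.Icc μ₁ μ₂, ∀ j, |M.energyCov Λ G β μ j| ≤ C₁ * |β| :=
    fun β μ h j => hM.abs_energyCov_le Λ (hA Λ μ (hμm μ h)) j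
  have hE₂ : ∀ β, ∀ μ ∈ Set.Icc μ₁ μ₂, ∀ j, |M.energyCov Λ G β μ j| ≤
      A * ((M.system Λ).fluctBound (vol Λ * t ^ 2) (t ^ 2) β (β * μ) / vol Λ) :=
    fun β μ h j => abs_energyCov_le_fluctBound Λ (hA Λ μ (hμm μ h)) j hη hy
  -- Treats both functions at once, with `x = 2 * R` for `g₁` and `x = 1` for `g₂`. The cutoff is `ε
  -- = t`: both `ε` and `t ^ 2 / ε` are then of order `t`.
  have key : ∀ (g : ℝ → ℝ → ℝ) (x : ℝ), 0 ≤ x →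
      (∀ β μ B, (∀ j, |M.energyCov Λ G β μ j| ≤ B) → |g β μ| ≤ x * B) →
      ∫ μ in μ₁..μ₂, ∫ β in β₁..β₂, |g β μ| ≤
        x * (4 * b * m * C₁ + 2 * b * m * A * C₃) * t := by
    intro g x hx hg
    refine (integral_integral_abs_le (b := b) (c := m) (δ := C₃ * t ^ 2)
      (Φ := fun q => (M.system Λ).fluctBound (vol Λ * t ^ 2) (t ^ 2) q.1 q.2 / vol Λ)
      (((M.system Λ).continuous_fluctBound _ _).div_const _)
      (fun q => div_nonneg ((M.system Λ).fluctBound_nonneg hη hy _ _) hv.le) hβ hμ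
      (le_max_left |β₁| |β₂|) (le_max_right _ _) (le_max_left |μ₁| |μ₂|) (le_max_right _ _)
      (hM.integral_fluctBound_div_vol_le Λ ht ht1 htv hβ (le_max_left _ _) (le_max_right _ _))
      (mul_nonneg hx hC₁) (mul_nonneg hx hA0) ht
      (fun β μ h => (hg β μ _ (hE₁ β μ h)).trans_eq (mul_assoc _ _ _).symm)
      (fun β μ h => (hg β μ _ (hE₂ β μ h)).trans_eq (mul_assoc _ _ _).symm)).trans_eq ?_
    field_simp
  refine ⟨key _ (2 * R) (by positivity) fun β μ B h => abs_g₁_le Λ h, ?_⟩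
  have := key (fun β μ => M.g₂ Λ G β μ) 1 zero_le_one fun β μ B h => by
    rw [g₂_eq_energyCov, one_mul]; exact h _
  simpa only [one_mul] using this

end Model

end SpinGlass

end

theorem theorem2 {d : ℕ} (hd : 1 ≤ d) (M : SpinGlass.Model d) (hM : M.Stable)
    (R : ℕ) (G : (Fin R → ℝ) × (Fin R → Fin R → ℝ) → ℝ) (hG : ContDiff ℝ ∞ G)
    (β₁ β₂ μ₁ μ₂ : ℝ) (hβ : β₁ ≤ β₂) (hμ : μ₁ ≤ μ₂) :
    Tendsto (fun Λ : SpinGlass.Box d => ∫ μ in μ₁..μ₂, ∫ β in β₁..β₂, |M.g₁ Λ G β μ|)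
      atTop (𝓝 0) ∧
    Tendsto (fun Λ : SpinGlass.Box d => ∫ μ in μ₁..μ₂, ∫ β in β₁..β₂, |M.g₂ Λ G β μ|)
      atTop (𝓝 0) := by
  obtain ⟨C, hC⟩ := hM
  have hC : M.StableWith C := hC
  obtain ⟨D, hD⟩ := hC.exists_integral_abs_le hG.continuous hβ hμ
  have ht : Tendsto (fun Λ : SpinGlass.Box d => SpinGlass.vol Λ ^ (-(1 / 8) : ℝ)) atTop (𝓝 0) :=
    (tendsto_rpow_neg_atTop (by norm_num)).comp (SpinGlass.tendsto_vol_atTop hd)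
  have hb : ∀ Λ : SpinGlass.Box d, _ := fun Λ => hD Λ (SpinGlass.vol Λ ^ (-(1 / 8) : ℝ))
    (Real.rpow_pos_of_pos (SpinGlass.vol_pos Λ) _)
    (Real.rpow_le_one_of_one_le_of_nonpos (SpinGlass.one_le_vol Λ) (by norm_num)) (by
      rw [← Real.rpow_natCast, ← Real.rpow_mul (SpinGlass.vol_pos Λ).le]
      norm_num [Real.rpow_neg_one, (SpinGlass.vol_pos Λ).ne'])
  have hnn : ∀ g : ℝ → ℝ → ℝ, 0 ≤ ∫ μ in μ₁..μ₂, ∫ β in β₁..β₂, |g β μ| := fun g =>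
    intervalIntegral.integral_nonneg hμ fun μ _ =>
      intervalIntegral.integral_nonneg hβ fun β _ => abs_nonneg _
  exact ⟨squeeze_zero (fun Λ => hnn _) (fun Λ => (hb Λ).1) (by simpa using ht.const_mul (2 * R * D)),
    squeeze_zero (fun Λ => hnn _) (fun Λ => (hb Λ).2) (by simpa using ht.const_mul D)⟩
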